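/- Let $n\ge 0$ and let $P([n])$ be the power set of $[n]=\{1,\dots,n\}$, the vertex set of the $n$-cube; write $\oplus$ for symmetric difference. **Orientations.** An orientation is a map $o:P([n])\to P([n])$ with $d\in o(v)\iff d\notin o(v\oplus\{d\})$ for all $v,d$. It is a USO if for all $a,D\subseteq[n]$ there is exactly one $v$ with $v\oplus a\subseteq D$ and $o(v)\cap D=\emptyset$. A Matoušek USO is a USO $m$ with $m(\emptyset)=\emptyset$ for which there is a directed graph $G=([n],E)$ with a loop at every vertex and no other directed cycle such that, for all $d,d'\in[n]$ and all $v$, exactly one of $d'\in m(v)$, $d'\in m(v\oplus\{d\})$ holds if and only if $(d,d')\in E$. Orientations $o,o'$ are isomorphic if there are $F\subseteq[n]$ and a permutation $\pi$ of $[n]$ with $\pi(o(v))=o'(\pi(v\oplus F))$ for all $v$. A Matoušek-type USO is a USO isomorphic to a Matoušek USO. An orientation $o$ is realizable if there are a P-matrix $M\in\mathbb R^{n\times n}$ (all principal minors positive) and $q\in\mathbb R^n$ such that, for every $B\subseteq[n]$, the unique solution $(w,z)$ of $w-Mz=q$, $w_i=0$ $(i\in B)$, $z_i=0$ $(i\notin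 B)$ has no $i$ with $w_i=z_i=0$, and $o(B)=\{i: w_i\le 0\text{ and }z_i\le 0\}$. **Oriented matroids.** Oriented matroids are given by their signed circuits. A real matrix realizes the oriented matroid on its columns whose circuits are the sign vectors of the nonzero linear dependencies with inclusion-minimal support. The alternating matroid $\mathcal A^{N,r}$ is realized by the columns $(1,x_i,\dots,x_i^{r-1})^T$, $i=1,\dots,N$, for real numbers $x_1<\dots<x_N$. On the ground set $[2n]$, the elements $i$ and $i+n$ are complementary. A P-matroid is an oriented matroid $\mathcal M$ on $[2n]$ such that $[n]$ and all $n$-element sets without a complementary pair are bases, and no circuit whose support contains exactly one complementary pair has different signs on the two elements of that pair. A cyclic-P-matroid is a P-matroid that becomes $\mathcal A^{2n,n}$ after flipping the signs of some set of elements and relabeling the elements by some bijection onto $[2n]$. A simple extension of a cyclic-P-matroid $\mathcal M$ is an oriented matroid $\hat{\mathcal M}$ on $[2n]\cup\{q\}$ such that the deletion $\hat{\mathcal M}\setminus q$ equals $\mathcal M$ and $\hat{\mathcal M}$ becomes $\mathcal A^{2n+1,n}$ after flipping the signs of some set of elements and relabeling by some bijection $\pi:[2n]\cup\{q\}\to[2n+1]$;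 here $\pi(q)$ is arbitrary. Its associated orientation $u$ is defined by: $i\in u(v)$ if and only if $i$ or $i+n$ is negative in the fundamental circuit of $q$ with respect to $\{i:i\notin v\}\cup\{i+n:i\in v\}$, i.e. the circuit supported in this set together with $q$ that is positive at $q$. **Theorem.** For every $n\ge 0$, the set of orientations of the $n$-cube associated with simple extensions of cyclic-P-matroids on $[2n]$ is exactly the set of realizable Matoušek-type USOs of the $n$-cube. Moreover, the realizable Matoušek-type USOs are exactly the orientations isomorphic to a realizable Matoušek USO. -/

import Mathlib

open scoped symmDiff Matrix

/-! ### Orientations of the hypercube -/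

/-- `o` is an orientation of the `n`-cube, given by its outmap: the edge between `v` and `v ∆ {d}`
leaves exactly one of its two end points. -/
def IsOrientation {n : ℕ} (o : Finset (Fin n) → Finset (Fin n)) : Prop :=
  ∀ v d, d ∈ o v ↔ d ∉ o (v ∆ {d})

/-- Unique sink orientations. The face through `a` spanned by the dimensions `D` consists of the
vertices `v` with `v ∆ a ⊆ D`. -/
def IsUSO {n : ℕ} (o : Finset (Fin n) → Finset (Fin n)) : Prop :=
  IsOrientation o ∧ ∀ a D : Finset (Fin n), ∃! v, v ∆ a ⊆ D ∧ o v ∩ D = ∅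

/-- `m` has dimension influence graph `G`: walking along an edge in dimension `d` changes the
outmap in dimension `d'` iff `(d, d')` is an edge of `G`. -/
def HasInfluenceGraph {n : ℕ} (m : Finset (Fin n) → Finset (Fin n)) (G : Digraph (Fin n)) : Prop :=
  ∀ (d d' : Fin n) (v : Finset (Fin n)), Xor (d' ∈ m v) (d' ∈ m (v ∆ {d})) ↔ G.Adj d d'

/-- `G` has a loop at every vertex and no other directed cycle. -/
def IsLoopedAcyclic {n : ℕ} (G : Digraph (Fin n)) : Prop :=
  (∀ d, G.Adj d d) ∧ ∀ d, ¬ Relation.TransGen (fun a b => a ≠ b ∧ G.Adj a b) d d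

/-- Matoušek USOs. -/
def IsMatousekUSO {n : ℕ} (m : Finset (Fin n) → Finset (Fin n)) : Prop :=
  IsUSO m ∧ m ∅ = ∅ ∧ ∃ G : Digraph (Fin n), IsLoopedAcyclic G ∧ HasInfluenceGraph m G

/-- Isomorphism of orientations: mirror along the dimensions in `F`, then permute by `π`. -/
def OrientationIso {n : ℕ} (o o' : Finset (Fin n) → Finset (Fin n)) : Prop :=
  ∃ (F : Finset (Fin n)) (π : Equiv.Perm (Fin n)), ∀ v, (o v).image π = o' ((v ∆ F).image π)

/-- Matoušek-type USOs: the USOs isomorphic to a Matoušek USO. -/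
def IsMatousekTypeUSO {n : ℕ} (u : Finset (Fin n) → Finset (Fin n)) : Prop :=
  IsUSO u ∧ ∃ m, IsMatousekUSO m ∧ OrientationIso m u

/-! ### The P-matrix linear complementarity problem -/

/-- A P-matrix: all principal minors are positive. -/
def IsPMatrix {n : ℕ} (M : Matrix (Fin n) (Fin n) ℝ) : Prop :=
  ∀ s : Finset (Fin n), 0 < (M.submatrix (fun i : s => (i : Fin n)) (fun i : s => (i : Fin n))).det

/-- `(w, z)` is a candidate solution of the LCP `(M, q)` corresponding to the vertex `B`. -/
def IsCandidate {n : ℕ} (M : Matrix (Fin n) (Fin n) ℝ) (q : Fin n → ℝ) (B : Finset (Fin n))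
    (w z : Fin n → ℝ) : Prop :=
  w - M *ᵥ z = q ∧ (∀ i ∈ B, w i = 0) ∧ (∀ i ∉ B, z i = 0)

/-- `q` is non-degenerate for `M`: no candidate solution has `w i = z i = 0` for some `i`. -/
def IsNondegenerate {n : ℕ} (M : Matrix (Fin n) (Fin n) ℝ) (q : Fin n → ℝ) : Prop :=
  ∀ B w z, IsCandidate M q B w z → ∀ i, ¬ (w i = 0 ∧ z i = 0)

/-- The LCP `(M, q)` induces the orientation `o`: the outmap at `B` consists of the `i` with
`w i, z i ≤ 0` in the candidate solution corresponding to `B` (which is unique if `M` is a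
P-matrix). -/
def LCPInduces {n : ℕ} (M : Matrix (Fin n) (Fin n) ℝ) (q : Fin n → ℝ)
    (o : Finset (Fin n) → Finset (Fin n)) : Prop :=
  ∀ B, ∃ w z, IsCandidate M q B w z ∧ ∀ i, i ∈ o B ↔ w i ≤ 0 ∧ z i ≤ 0

/-- Realizable orientations: those induced by a non-degenerate P-LCP instance. -/
def IsRealizable {n : ℕ} (o : Finset (Fin n) → Finset (Fin n)) : Prop :=
  ∃ (M : Matrix (Fin n) (Fin n) ℝ) (q : Fin n → ℝ),
    IsPMatrix M ∧ IsNondegenerate M q ∧ LCPInduces M q o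

/-! ### Oriented matroids -/

/-- The support of a signed set. A signed set `(X⁺, X⁻)` on `E` is encoded as the function
`X : E → SignType` with `X⁺ = {e | X e = 1}` and `X⁻ = {e | X e = -1}`. -/
def signSupport {E : Type*} (X : E → SignType) : Set E := {e | X e ≠ 0}

/-- Oriented matroids in circuit representation. -/
@[ext]
structure OrientedMatroid (E : Type*) where
  /-- The circuits. -/
  circuits : Set (E → SignType)
  zero_notMem : (0 : E → SignType) ∉ circuits
  neg_mem : ∀ X ∈ circuits, -X ∈ circuits
  incomparable : ∀ X ∈ circuits, ∀ Y ∈ circuits, signSupport X ⊆ signSupport Y → X = Y ∨ X = -Y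
  elimination : ∀ X ∈ circuits, ∀ Y ∈ circuits, X ≠ -Y → ∀ e, X e = 1 → Y e = -1 →
    ∃ Z ∈ circuits, (∀ f, Z f = 1 → (X f = 1 ∨ Y f = 1) ∧ f ≠ e) ∧
      (∀ f, Z f = -1 → (X f = -1 ∨ Y f = -1) ∧ f ≠ e)

namespace OrientedMatroid

variable {E E' : Type*}

/-- A basis: an inclusion-maximal set containing no circuit. -/
def IsBasis (M : OrientedMatroid E) (B : Set E) : Prop :=
  Maximal (fun A => ∀ C ∈ M.circuits, ¬ signSupport C ⊆ A) B

/-- `C` is the fundamental circuit `C(B, e)`: the circuit supported in `B ∪ {e}` that is positive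
at `e`. (In a uniform oriented matroid its support is all of `B ∪ {e}`.) -/
def IsFundamentalCircuit (M : OrientedMatroid E) (B : Set E) (e : E) (C : E → SignType) : Prop :=
  C ∈ M.circuits ∧ signSupport C ⊆ insert e B ∧ C e = 1

/-- Relabeling: the element `e` receives the new label `π e`. -/
def relabel (M : OrientedMatroid E) (π : E ≃ E') : OrientedMatroid E' where
  circuits := {X | X ∘ π ∈ M.circuits}
  zero_notMem := M.zero_notMem
  neg_mem X hX := M.neg_mem _ hX
  incomparable X hX Y hY h := by
    have := M.incomparable _ hX _ hY (fun e he => h (a := π e) he)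
    refine this.imp (fun h => ?_) (fun h => ?_) <;> funext e <;>
      simpa using congrFun h (π.symm e)
  elimination X hX Y hY hne e h1 h2 := by
    obtain ⟨Z, hZ, hp, hn⟩ := M.elimination _ hX _ hY
      (fun h => hne (by funext e; simpa using congrFun h (π.symm e))) (π.symm e)
      (by simpa using h1) (by simpa using h2)
    refine ⟨Z ∘ π.symm, by simpa [Function.comp_assoc] using hZ, fun f hf => ?_, fun f hf => ?_⟩
    · simpa using hp (π.symm f) hf
    · simpa using hn (π.symm f) hf

/-- Flip the signs of the elements of `F` in a signed set. -/
def flip [DecidableEq E] (F : Finset E) (X : E → SignType) : E → SignType :=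
  fun e => if e ∈ F then -X e else X e

theorem flip_neg [DecidableEq E] (F : Finset E) (X : E → SignType) : flip F (-X) = -flip F X := by
  funext e
  by_cases h : e ∈ F <;> simp [flip, h]

theorem flip_flip [DecidableEq E] (F : Finset E) (X : E → SignType) : flip F (flip F X) = X := by
  funext e
  by_cases h : e ∈ F <;> simp [flip, h]

theorem signSupport_flip [DecidableEq E] (F : Finset E) (X : E → SignType) :
    signSupport (flip F X) = signSupport X := by
  ext e
  by_cases h : e ∈ F <;> simp [flip, h, signSupport]

/-- Reorientation: the signs of the elements of `F` are flipped in all circuits. -/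
def reorient [DecidableEq E] (M : OrientedMatroid E) (F : Finset E) : OrientedMatroid E where
  circuits := {X | flip F X ∈ M.circuits}
  zero_notMem h := M.zero_notMem (by
    have h0 : flip F (0 : E → SignType) = 0 := by
      funext e
      by_cases h : e ∈ F <;> simp [flip, h]
    simpa [h0] using h)
  neg_mem X hX := by
    simpa [flip_neg] using M.neg_mem _ hX
  incomparable X hX Y hY h := by
    have := M.incomparable _ hX _ hY (by simpa only [signSupport_flip] using h)
    refine this.imp (fun h => ?_) (fun h => ?_)
    · simpa [flip_flip] using congrArg (flip F) h
    · simpa [flip_flip, flip_neg] using congrArg (flip F) h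
  elimination X hX Y hY hne e h1 h2 := by
    have hne' : flip F X ≠ -flip F Y := fun h => hne (by
      simpa [flip_flip, flip_neg] using congrArg (flip F) h)
    by_cases he : e ∈ F
    · obtain ⟨Z, hZ, hp, hn⟩ := M.elimination _ hY _ hX
        (fun h => hne' (by simpa using congrArg Neg.neg h.symm)) e (by simp [flip, he, h2])
        (by simp [flip, he, h1])
      refine ⟨flip F Z, by simpa [flip_flip] using hZ, fun f hf => ?_, fun f hf => ?_⟩ <;>
        have hp := hp f <;> have hn := hn f <;>
        by_cases hfF : f ∈ F <;> simp only [flip, hfF, if_true, if_false, neg_eq_iff_eq_neg,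
          neg_neg] at hf hp hn <;> tauto
    · obtain ⟨Z, hZ, hp, hn⟩ := M.elimination _ hX _ hY hne' e (by simp [flip, he, h1])
        (by simp [flip, he, h2])
      refine ⟨flip F Z, by simpa [flip_flip] using hZ, fun f hf => ?_, fun f hf => ?_⟩ <;>
        have hp := hp f <;> have hn := hn f <;>
        by_cases hfF : f ∈ F <;> simp only [flip, hfF, if_true, if_false, neg_eq_iff_eq_neg,
          neg_neg] at hf hp hn <;> tauto

/-- Extend a signed set on `E` by zero at the additional element `none`. -/
def extendZero (X : E → SignType) : Option E → SignType := fun o => o.elim 0 X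

/-- The deletion minor of an oriented matroid on `E ∪ {q}`, with `q = none`: its circuits are the
circuits that vanish at `q`. -/
def deletion (M : OrientedMatroid (Option E)) : OrientedMatroid E where
  circuits := {X | extendZero X ∈ M.circuits}
  zero_notMem h := M.zero_notMem (by
    have h0 : extendZero (0 : E → SignType) = 0 := by
      funext e; cases e <;> rfl
    simpa [h0] using h)
  neg_mem X hX := by
    have h0 : extendZero (-X) = -extendZero X := by
      funext e; cases e <;> simp [extendZero]
    simpa [h0] using M.neg_mem _ hX
  incomparable X hX Y hY h := by
    have := M.incomparable _ hX _ hY (by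
      rintro (_ | e) he
      · simp [signSupport, extendZero] at he
      · exact h (a := e) he)
    refine this.imp (fun h => ?_) (fun h => ?_) <;> funext e <;>
      simpa [extendZero] using congrFun h (some e)
  elimination X hX Y hY hne e h1 h2 := by
    obtain ⟨Z, hZ, hp, hn⟩ := M.elimination _ hX _ hY
      (fun h => hne (by funext e; simpa [extendZero] using congrFun h (some e))) (some e) h1 h2
    have hZ0 : Z none = 0 := by
      have hp := hp none
      have hn := hn none
      simp only [extendZero, Option.elim_none] at hp hn
      rcases h : Z none with _ | _ | _
      · rfl
      · exact absurd (hn h).1 (by decide)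
      · exact absurd (hp h).1 (by decide)
    have hZ' : extendZero (fun f => Z (some f)) = Z := by
      funext f; cases f <;> simp [extendZero, hZ0]
    refine ⟨fun f => Z (some f), by simpa [hZ'] using hZ, fun f hf => ?_, fun f hf => ?_⟩
    · simpa [extendZero] using hp (some f) hf
    · simpa [extendZero] using hn (some f) hf

end OrientedMatroid

/-! ### Oriented matroids of vector configurations -/

/-- `x` is an inclusion-minimal (nonzero) linear dependency of the columns of `V`. -/
def IsMinimalDependency {E : Type*} [Fintype E] {r : ℕ} (V : Matrix (Fin r) E ℝ) (x : E → ℝ) :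
    Prop :=
  x ≠ 0 ∧ V *ᵥ x = 0 ∧
    ∀ y : E → ℝ, y ≠ 0 → V *ᵥ y = 0 → ¬ Function.support y ⊂ Function.support x

/-- The signed set of the signs of a real vector. -/
noncomputable def signVector {E : Type*} (x : E → ℝ) : E → SignType := fun e => SignType.sign (x e)

theorem signSupport_signVector {E : Type*} (x : E → ℝ) :
    signSupport (signVector x) = Function.support x := by
  ext e
  simp [signSupport, signVector]

theorem signVector_neg {E : Type*} (x : E → ℝ) : signVector (-x) = -signVector x := by
  funext e
  simp [signVector, Left.sign_neg]

theorem signVector_smul_pos {E : Type*} {c : ℝ} (hc : 0 < c) (x : E → ℝ) :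
    signVector (c • x) = signVector x := by
  funext e
  simp [signVector, sign_mul, sign_pos hc]

/-- Every nonzero linear dependency contains a sign-conformal minimal one. -/
theorem exists_conformal {E : Type*} [Fintype E] {r : ℕ} (V : Matrix (Fin r) E ℝ) :
    ∀ (k : ℕ) (z : E → ℝ), (Function.support z).ncard = k → z ≠ 0 → V *ᵥ z = 0 →
      ∃ x, IsMinimalDependency V x ∧ ∀ e, (0 < x e → 0 < z e) ∧ (x e < 0 → z e < 0) := by
  intro k
  induction k using Nat.strong_induction_on with
  | _ k ih =>
  intro z hk hz hVz
  by_cases hmin : IsMinimalDependency V z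
  · exact ⟨z, hmin, fun e => ⟨id, id⟩⟩
  obtain ⟨y, hy0, hVy, hsub, i, hi⟩ : ∃ y : E → ℝ, y ≠ 0 ∧ V *ᵥ y = 0 ∧
      Function.support y ⊂ Function.support z ∧ ∃ i, 0 < z i * y i := by
    simp only [IsMinimalDependency, not_and, not_forall, not_not] at hmin
    obtain ⟨y, hy0, hVy, hsub⟩ := hmin hz hVz
    obtain ⟨i, hi⟩ := Function.ne_iff.1 hy0
    have hzi : z i ≠ 0 := hsub.1 hi
    rcases lt_or_gt_of_ne (mul_ne_zero hzi hi) with h | h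
    · refine ⟨-y, neg_ne_zero.2 hy0, by rw [Matrix.mulVec_neg, hVy, neg_zero],
        by simpa using hsub, i, ?_⟩
      simpa using h
    · exact ⟨y, hy0, hVy, hsub, i, h⟩
  obtain ⟨j, hj, hjmin⟩ := Finset.exists_min_image
    (Finset.univ.filter fun i => 0 < z i * y i) (fun i => z i / y i) ⟨i, by simpa using hi⟩
  simp only [Finset.mem_filter, Finset.mem_univ, true_and] at hj hjmin
  set t := z j / y j with ht
  have hyj : y j ≠ 0 := fun h => by simp [h] at hj
  have htpos : 0 < t := by
    rw [ht, ← mul_div_mul_right _ _ hyj]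
    exact div_pos hj (mul_self_pos.2 hyj)
  have hw : ∀ e, (0 < z e - t * y e → 0 < z e) ∧ (z e - t * y e < 0 → z e < 0) := by
    intro e
    by_cases hye : y e = 0
    · simp [hye]
    have hze : z e ≠ 0 := hsub.1 hye
    rcases lt_or_gt_of_ne hze with h | h
    · refine ⟨fun hp => ?_, fun _ => h⟩
      exfalso
      have hyneg : y e < 0 := by
        by_contra hcon
        nlinarith [mul_nonneg htpos.le (not_lt.1 hcon)]
      have := hjmin e (mul_pos_of_neg_of_neg h hyneg)
      rw [le_div_iff_of_neg hyneg] at this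
      linarith
    · refine ⟨fun _ => h, fun hp => ?_⟩
      exfalso
      have hypos : 0 < y e := by
        by_contra hcon
        nlinarith [mul_nonneg htpos.le (neg_nonneg.2 (not_lt.1 hcon))]
      have := hjmin e (mul_pos h hypos)
      rw [le_div_iff₀ hypos] at this
      linarith
  have hlt : Function.support (z - t • y) ⊂ Function.support z := by
    refine ⟨fun e he hze => ?_, fun hsup => ?_⟩
    · have hye : y e = 0 := by
        by_contra h
        exact hsub.1 h hze
      exact he (by simp [hze, hye])
    · have hzj : z j ≠ 0 := hsub.1 hyj
      exact hsup hzj (by simp [ht, hyj])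
  have hne : z - t • y ≠ 0 := by
    intro h
    refine hsub.2 (fun e he hye => he ?_)
    have := congrFun h e
    simpa [hye] using this
  obtain ⟨x, hx, hxz⟩ := ih _ (by rw [← hk]; exact Set.ncard_lt_ncard hlt (Set.toFinite _))
    (z - t • y) rfl hne (by rw [Matrix.mulVec_sub, Matrix.mulVec_smul, hVz, hVy]; simp)
  exact ⟨x, hx, fun e => ⟨fun h => (hw e).1 (by simpa using (hxz e).1 h),
    fun h => (hw e).2 (by simpa using (hxz e).2 h)⟩⟩

/-- The oriented matroid realized by the columns of `V`. -/
noncomputable def OrientedMatroid.ofMatrix {E : Type*} [Fintype E] {r : ℕ}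
    (V : Matrix (Fin r) E ℝ) : OrientedMatroid E where
  circuits := {X | ∃ x, IsMinimalDependency V x ∧ X = signVector x}
  zero_notMem := by
    rintro ⟨x, hx, h⟩
    refine hx.1 (Function.support_eq_empty_iff.1 ?_)
    rw [← signSupport_signVector, ← h]
    simp [signSupport]
  neg_mem := by
    rintro _ ⟨x, hx, rfl⟩
    refine ⟨-x, ⟨neg_ne_zero.2 hx.1, by rw [Matrix.mulVec_neg, hx.2.1, neg_zero], ?_⟩,
      (signVector_neg x).symm⟩
    simpa using hx.2.2
  incomparable := by
    rintro _ ⟨x, hx, rfl⟩ _ ⟨y, hy, rfl⟩ h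
    rw [signSupport_signVector, signSupport_signVector] at h
    obtain ⟨i, hi⟩ := Function.ne_iff.1 hx.1
    have hxi : x i ≠ 0 := hi
    have hyi : y i ≠ 0 := h hi
    set c := x i / y i with hc
    have hc0 : c ≠ 0 := div_ne_zero hxi hyi
    have hxy : x = c • y := by
      by_contra hne
      refine hy.2.2 (x - c • y) (sub_ne_zero.2 hne)
        (by rw [Matrix.mulVec_sub, Matrix.mulVec_smul, hx.2.1, hy.2.1]; simp)
        ⟨fun e he hye => ?_, fun hsup => ?_⟩
      · have hxe : x e = 0 := by
          by_contra h'
          exact h h' hye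
        exact he (by simp [hxe, hye])
      · exact hsup hyi (by simp [hc, hyi])
    rcases lt_or_gt_of_ne hc0 with hneg | hpos
    · right
      have hx' : x = -((-c) • y) := by rw [hxy]; simp
      rw [hx', signVector_neg, signVector_smul_pos (neg_pos.2 hneg)]
    · left
      rw [hxy, signVector_smul_pos hpos]
  elimination := by
    rintro _ ⟨x, hx, rfl⟩ _ ⟨y, hy, rfl⟩ hne e h1 h2
    simp only [signVector, sign_eq_one_iff, sign_eq_neg_one_iff] at h1 h2
    have hz0 : (-y e) • x + x e • y ≠ 0 := by
      intro h
      apply hne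
      have h' : (-y e) • x = -(x e • y) := eq_neg_of_add_eq_zero_left h
      rw [← signVector_smul_pos (neg_pos.2 h2) x, h', signVector_neg, signVector_smul_pos h1]
    obtain ⟨w, hw, hwz⟩ := exists_conformal V _ _ rfl hz0
      (by rw [Matrix.mulVec_add, Matrix.mulVec_smul, Matrix.mulVec_smul, hx.2.1, hy.2.1]; simp)
    refine ⟨_, ⟨w, hw, rfl⟩, fun f hf => ?_, fun f hf => ?_⟩
    · simp only [signVector, sign_eq_one_iff] at hf ⊢
      have := (hwz f).1 hf
      simp only [Pi.add_apply, Pi.smul_apply, smul_eq_mul] at this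
      refine ⟨?_, ?_⟩
      · by_contra! hcon
        nlinarith [mul_nonneg (neg_pos.2 h2).le (neg_nonneg.2 hcon.1),
          mul_nonneg h1.le (neg_nonneg.2 hcon.2)]
      · rintro rfl
        linarith
    · simp only [signVector, sign_eq_neg_one_iff] at hf ⊢
      have := (hwz f).2 hf
      simp only [Pi.add_apply, Pi.smul_apply, smul_eq_mul] at this
      refine ⟨?_, ?_⟩
      · by_contra! hcon
        nlinarith [mul_nonneg (neg_pos.2 h2).le hcon.1, mul_nonneg h1.le hcon.2]
      · rintro rfl
        linarith

/-- The matrix whose columns are the points `(1, x i, …, (x i) ^ (r - 1))` on the moment curve. -/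
def momentMatrix (r : ℕ) {N : ℕ} (x : Fin N → ℝ) : Matrix (Fin r) (Fin N) ℝ :=
  Matrix.of fun k i => x i ^ (k : ℕ)

/-- `A` is the alternating oriented matroid of rank `r` on `N` elements: it is realized by `N`
sequential points on the moment curve. (It does not depend on the choice of the points.) -/
def IsAlternating (r N : ℕ) (A : OrientedMatroid (Fin N)) : Prop :=
  ∃ x : Fin N → ℝ, StrictMono x ∧ A = OrientedMatroid.ofMatrix (momentMatrix r x)

/-! ### P-matroids and their extensions -/

/-- The ground set of `2n` elements: `Sum.inl i` is the element `i` and `Sum.inr i` is its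
complementary element `i + n`. -/
abbrev PGround (n : ℕ) : Type := Fin n ⊕ Fin n

/-- P-matroids. -/
def IsPMatroid {n : ℕ} (M : OrientedMatroid (PGround n)) : Prop :=
  M.IsBasis (Set.range Sum.inl) ∧
  (∀ B : Set (PGround n), B.ncard = n → (∀ i, ¬ (Sum.inl i ∈ B ∧ Sum.inr i ∈ B)) → M.IsBasis B) ∧
  ¬ ∃ C ∈ M.circuits, ∃ i : Fin n,
    (∀ j, (Sum.inl j ∈ signSupport C ∧ Sum.inr j ∈ signSupport C) ↔ j = i) ∧
    C (Sum.inl i) ≠ C (Sum.inr i)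

/-- Cyclic-P-matroids: P-matroids that become the alternating matroid of rank `n` on `2n` elements
after a reorientation and a relabeling. -/
def IsCyclicPMatroid {n : ℕ} (M : OrientedMatroid (PGround n)) : Prop :=
  IsPMatroid M ∧ ∃ (π : PGround n ≃ Fin (2 * n)) (F : Finset (PGround n)),
    IsAlternating n (2 * n) ((M.reorient F).relabel π)

/-- `Mhat`, on the ground set with the additional element `q = none`, is an extension of `M`. -/
def IsExtension {n : ℕ} (Mhat : OrientedMatroid (Option (PGround n)))
    (M : OrientedMatroid (PGround n)) : Prop :=
  Mhat.deletion = M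

/-- `Mhat` is a simple extension of the cyclic-P-matroid `M`: it is an extension of `M` realized by
taking `q` to be an additional point on the moment curve, i.e. up to a reorientation and a
relabeling `π` (which may put `q` at any position) it is the alternating matroid of rank `n` on
`2n + 1` elements. -/
def IsSimpleExtension {n : ℕ} (Mhat : OrientedMatroid (Option (PGround n)))
    (M : OrientedMatroid (PGround n)) : Prop :=
  IsCyclicPMatroid M ∧ IsExtension Mhat M ∧
    ∃ (π : Option (PGround n) ≃ Fin (2 * n + 1)) (F : Finset (Option (PGround n))),
      IsAlternating n (2 * n + 1) ((Mhat.reorient F).relabel π)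

/-- The complementary set belonging to the vertex `v`: it contains `i` for `i ∉ v` and `i + n` for
`i ∈ v`. -/
def vertexBasis {n : ℕ} (v : Finset (Fin n)) : Set (PGround n) :=
  {e | Sum.elim (fun i => i ∉ v) (fun i => i ∈ v) e}

/-- `u` is the orientation associated with the extension `Mhat` of a P-matroid: `i ∈ u v` iff `i`
or `i + n` is negative in the fundamental circuit of `q` with respect to `vertexBasis v`. -/
def IsAssociatedOrientation {n : ℕ} (Mhat : OrientedMatroid (Option (PGround n)))
    (u : Finset (Fin n) → Finset (Fin n)) : Prop :=
  ∀ v, ∃ C, Mhat.IsFundamentalCircuit (some '' vertexBasis v) none C ∧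
    ∀ i, i ∈ u v ↔ C (some (Sum.inl i)) = -1 ∨ C (some (Sum.inr i)) = -1

/-! ### Influence graphs -/

/-! Everything is read off the influence graph. An orientation with an influence graph is determined
by that graph and one value (`HasInfluenceGraph.ext`). A looped acyclic influence graph already
forces unique sinks, so having one characterizes Matoušek-type USOs (`isMatousekTypeUSO_iff`).

For these USOs realizability is equivalent to the strict part of the graph being a forest order:
transitive, with the predecessors of each element forming a chain. Necessity
(`IsRealizable.isForestOrder`) comes from three dimensions at a time: a linear relation among the
candidate solutions at four vertices would otherwise have contradictory signs.

Sufficiency and the link with alternating matroids use determinants of scaled points on the moment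
curve. By Cramer's rule their signs give the circuits of the matroid and also the solutions of an
LCP, so associated orientations are realizable (`isRealizable_of_configuration`). By the Vandermonde
formula, replacing a point by its complement changes signs according to which points lie between the
two. The P-property thus makes the complementary pairs non-crossing, and the associated orientation
has an edge from `d` to `i` exactly when the pair `d` separates the pair `i` from `q`. This nesting
relation is acyclic.

Conversely, a forest order is the containment order of nested or disjoint intervals. Their end
points serve as the complementary pairs, with `q` to the right of all of them. The scaling signs are
chosen to give the P-property and the right outmap at `∅`; uniqueness from graph and value then
gives the whole orientation (`HasInfluenceGraph.exists_configuration`). Since isomorphisms only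
permute the graph, realizability passes between a Matoušek USO and its isomorphic copies. -/

theorem Finset.insert_eq_symmDiff {α : Type*} [DecidableEq α] {e : α} {W : Finset α}
    (he : e ∉ W) : insert e W = W ∆ {e} := by
  ext x
  by_cases hx : x = e
  · subst hx; simp [Finset.mem_symmDiff, he]
  · simp [Finset.mem_symmDiff, hx]

section Influence

variable {n : ℕ} {o o' : Finset (Fin n) → Finset (Fin n)} {G : Digraph (Fin n)}

theorem HasInfluenceGraph.mem_symmDiff_singleton (h : HasInfluenceGraph o G) (v : Finset (Fin n))
    (d d' : Fin n) : (d' ∈ o (v ∆ {d}) ↔ d' ∈ o v) ↔ ¬ G.Adj d d' := by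
  have := h d d' v
  rw [xor_iff_not_iff] at this
  tauto

theorem HasInfluenceGraph.isOrientation (h : HasInfluenceGraph o G) (hG : ∀ d, G.Adj d d) :
    IsOrientation o := by
  intro v d
  have := h.mem_symmDiff_singleton v d d
  have := hG d
  tauto

theorem HasInfluenceGraph.mem_symmDiff_of_not_adj (h : HasInfluenceGraph o G) {d : Fin n}
    (W : Finset (Fin n)) (hW : ∀ e ∈ W, ¬ G.Adj e d) (v : Finset (Fin n)) :
    d ∈ o (v ∆ W) ↔ d ∈ o v := by
  induction W using Finset.induction_on with
  | empty => rw [← Finset.bot_eq_empty, symmDiff_bot]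
  | insert e W he ih =>
    rw [Finset.insert_eq_symmDiff he, ← symmDiff_assoc,
      (h.mem_symmDiff_singleton _ e d).2 (hW e (Finset.mem_insert_self _ _))]
    exact ih fun x hx => hW x (Finset.mem_insert_of_mem hx)

/-- An orientation is determined by its influence graph and one of its values. -/
theorem HasInfluenceGraph.ext (h : HasInfluenceGraph o G) (h' : HasInfluenceGraph o' G)
    (h0 : o ∅ = o' ∅) : o = o' := by
  funext v
  induction v using Finset.induction_on with
  | empty => exact h0
  | insert e W he ih =>
    ext d
    have h1 := h.mem_symmDiff_singleton W e d
    have h2 := h'.mem_symmDiff_singleton W e d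
    rw [Finset.insert_eq_symmDiff he]
    rw [ih] at h1
    tauto

theorem IsLoopedAcyclic.exists_minimal (hG : IsLoopedAcyclic G) {W : Finset (Fin n)}
    (hW : W.Nonempty) : ∃ d ∈ W, ∀ e ∈ W, e ≠ d → ¬ G.Adj e d := by
  have : Std.Irrefl (Relation.TransGen fun a b => a ≠ b ∧ G.Adj a b) := ⟨hG.2⟩
  have hwf := Finite.wellFounded_of_trans_of_irrefl
    (Relation.TransGen fun a b => a ≠ b ∧ G.Adj a b)
  obtain ⟨d, hd, hmin⟩ := hwf.has_min (W : Set (Fin n)) hW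
  exact ⟨d, hd, fun e he hne hadj => hmin e he (.single ⟨hne, hadj⟩)⟩

/-- Among the coordinates where the two vertices differ, take one, `d`, influenced by no other of
them. Flipping the others leaves membership of `d` in the outmap alone and flipping `d` itself
toggles it, so the outmaps differ at `d`. -/
theorem HasInfluenceGraph.injective_on_face (h : HasInfluenceGraph o G) (hG : IsLoopedAcyclic G)
    {v v' D : Finset (Fin n)} (hD : v ∆ v' ⊆ D) (heq : o v ∩ D = o v' ∩ D) : v = v' := by
  by_contra hne
  obtain ⟨d, hd, hmin⟩ := hG.exists_minimal (W := v ∆ v')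
    (Finset.nonempty_iff_ne_empty.2 fun he => hne (symmDiff_eq_bot.1 he))
  have h1 := h.mem_symmDiff_of_not_adj (d := d) ((v ∆ v').erase d)
    (fun e he => hmin e (Finset.mem_of_mem_erase he) (Finset.ne_of_mem_erase he)) v
  have h2 : v' = (v ∆ (v ∆ v').erase d) ∆ {d} := by
    ext x
    by_cases hx : x = d
    · subst hx
      simp only [Finset.mem_symmDiff, Finset.mem_erase, Finset.mem_singleton] at hd ⊢
      tauto
    · simp only [Finset.mem_symmDiff, Finset.mem_erase, Finset.mem_singleton] at hd ⊢
      tauto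
  have h3 := h.mem_symmDiff_singleton (v ∆ (v ∆ v').erase d) d d
  rw [← h2, h1] at h3
  have h4 := congrArg (d ∈ ·) heq
  simp only [Finset.mem_inter, hD hd, and_true, eq_iff_iff] at h4
  exact h3.1 h4.symm (hG.1 d)

/-- On a face the outmap, restricted to the spanning dimensions, is an injective self-map of a
finite set; hence it is also surjective and takes the value `∅` exactly once. -/
theorem HasInfluenceGraph.isUSO (h : HasInfluenceGraph o G) (hG : IsLoopedAcyclic G) :
    IsUSO o := by
  refine ⟨h.isOrientation hG.1, fun a D => ?_⟩
  let φ : {W : Finset (Fin n) // W ⊆ D} → {W : Finset (Fin n) // W ⊆ D} :=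
    fun W => ⟨o (a ∆ W) ∩ D, Finset.inter_subset_right⟩
  have hφ : Function.Injective φ := by
    intro W W' hWW
    have heq : o (a ∆ W) ∩ D = o (a ∆ W') ∩ D := congrArg Subtype.val hWW
    have := h.injective_on_face hG (D := D) (by
      rw [symmDiff_symmDiff_symmDiff_comm, symmDiff_self, bot_symmDiff]
      exact symmDiff_le_sup.trans (Finset.union_subset W.2 W'.2)) heq
    exact Subtype.ext (symmDiff_right_injective a this)
  obtain ⟨W, hW⟩ := Finite.surjective_of_injective hφ ⟨∅, Finset.empty_subset D⟩
  have hW' : o (a ∆ W) ∩ D = ∅ := congrArg Subtype.val hW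
  refine ⟨a ∆ W, ⟨?_, hW'⟩, fun v hv => ?_⟩
  · rw [symmDiff_comm a, symmDiff_symmDiff_cancel_right]
    exact W.2
  · refine h.injective_on_face hG (D := D) ?_ (hv.2.trans hW'.symm)
    rw [← symmDiff_assoc]
    exact symmDiff_le_sup.trans (Finset.union_subset hv.1 W.2)

/-- The image of a digraph under a permutation of its vertices. -/
def Digraph.permute (G : Digraph (Fin n)) (π : Equiv.Perm (Fin n)) : Digraph (Fin n) where
  Adj a b := G.Adj (π.symm a) (π.symm b)

theorem IsLoopedAcyclic.permute (hG : IsLoopedAcyclic G) (π : Equiv.Perm (Fin n)) :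
    IsLoopedAcyclic (G.permute π) := by
  refine ⟨fun d => hG.1 _, fun d hd => hG.2 (π.symm d) ?_⟩
  exact Relation.TransGen.lift (p := fun a b => a ≠ b ∧ G.Adj a b) π.symm
    (fun a b hab => ⟨π.symm.injective.ne hab.1, hab.2⟩) d d hd

/-- Mirroring along `F` only translates the vertex, and the influence relation is the same at all
vertices; so only `π` acts on the graph. -/
theorem OrientationIso.hasInfluenceGraph (h : OrientationIso o o') (hG : HasInfluenceGraph o G) :
    ∃ π : Equiv.Perm (Fin n), HasInfluenceGraph o' (G.permute π) := by
  obtain ⟨F, π, hπ⟩ := h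
  refine ⟨π, fun d d' v => ?_⟩
  have key : ∀ v, d' ∈ o' v ↔ π.symm d' ∈ o (v.image π.symm ∆ F) := by
    intro v
    have := hπ (v.image π.symm ∆ F)
    rw [symmDiff_symmDiff_cancel_right, Finset.image_image] at this
    simp only [Equiv.self_comp_symm, Finset.image_id] at this
    rw [← this]
    rw [Finset.mem_image]
    exact ⟨fun ⟨a, ha, hd⟩ => by rwa [← hd, Equiv.symm_apply_apply],
      fun hd => ⟨_, hd, Equiv.apply_symm_apply _ _⟩⟩
  rw [key, key, Finset.image_symmDiff _ _ π.symm.injective, Finset.image_singleton,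
    symmDiff_right_comm]
  exact hG _ _ _

/-- Matoušek-type USOs are the orientations with an acyclic influence graph. -/
theorem isMatousekTypeUSO_iff :
    IsMatousekTypeUSO o ↔ ∃ G, IsLoopedAcyclic G ∧ HasInfluenceGraph o G := by
  constructor
  · rintro ⟨-, m, ⟨-, -, G, hG, hm⟩, hiso⟩
    obtain ⟨π, hπ⟩ := hiso.hasInfluenceGraph hm
    exact ⟨_, hG.permute π, hπ⟩
  · rintro ⟨G, hG, ho⟩
    have hU := ho.isUSO hG
    -- `F` is the sink of the whole cube; mirroring along it moves the sink to `∅`.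
    obtain ⟨F, hF, -⟩ := hU.2 ∅ Finset.univ
    have hm : HasInfluenceGraph (fun v => o (v ∆ F)) G := fun d d' v => by
      simpa only [symmDiff_right_comm v {d} F] using ho d d' (v ∆ F)
    refine ⟨hU, fun v => o (v ∆ F), ⟨hm.isUSO hG, ?_, G, hG, hm⟩, F, 1, fun v => ?_⟩
    · simpa [← Finset.bot_eq_empty] using hF.2
    · simp

end Influence

/-! ### Influence graphs of realizable orientations -/

theorem mul_pos_of_sign_iff {x y : ℝ} {p q : Prop} (hx : x ≠ 0) (hy : y ≠ 0) (hp : p ↔ x ≤ 0)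
    (hq : q ↔ y ≤ 0) (h : p ↔ q) : 0 < x * y := by
  rw [hp, hq] at h
  rcases lt_or_gt_of_ne hx with h1 | h1 <;> rcases lt_or_gt_of_ne hy with h2 | h2
  · exact mul_pos_of_neg_of_neg h1 h2
  · exact absurd (h.1 h1.le) (not_le.2 h2)
  · exact absurd (h.2 h2.le) (not_le.2 h1)
  · exact mul_pos h1 h2

theorem mul_neg_of_sign_iff {x y : ℝ} {p q : Prop} (hx : x ≠ 0) (hy : y ≠ 0) (hp : p ↔ x ≤ 0)
    (hq : q ↔ y ≤ 0) (h : ¬ (p ↔ q)) : x * y < 0 := by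
  have := mul_pos_of_sign_iff hx (neg_ne_zero.2 hy) hp (q := ¬ q)
    (by rw [hq, not_le, Left.neg_nonpos_iff]; exact ⟨le_of_lt, fun h => lt_of_le_of_ne h hy.symm⟩)
    (by tauto)
  linarith

theorem LCPInduces.candidate {n : ℕ} {M : Matrix (Fin n) (Fin n) ℝ} {q : Fin n → ℝ}
    {o : Finset (Fin n) → Finset (Fin n)} (hn : IsNondegenerate M q) (h : LCPInduces M q o)
    (B : Finset (Fin n)) : ∃ w z : Fin n → ℝ, (∀ i, w i = q i + (M *ᵥ z) i) ∧
      (∀ i ∈ B, w i = 0 ∧ z i ≠ 0 ∧ (i ∈ o B ↔ z i ≤ 0)) ∧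
      (∀ i ∉ B, z i = 0 ∧ w i ≠ 0 ∧ (i ∈ o B ↔ w i ≤ 0)) := by
  obtain ⟨w, z, hc, ho⟩ := h B
  have hnd := hn B w z hc
  refine ⟨w, z, fun i => ?_, fun i hi => ?_, fun i hi => ?_⟩
  · have := congrFun hc.1 i
    simp only [Pi.sub_apply] at this
    linarith
  · have hw := hc.2.1 i hi
    exact ⟨hw, fun hz => hnd i ⟨hw, hz⟩, by rw [ho, hw]; simp⟩
  · have hz := hc.2.2 i hi
    exact ⟨hz, fun hw => hnd i ⟨hw, hz⟩, by rw [ho, hz]; simp⟩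

/-- Indices 1 to 4 stand for the vertices `∅`, `{b}`, `{a}`, `{a, b}`; `s` and `t` are the nonzero
coordinates at `a`, `y` those at `b`, and `c` those at a third dimension. Multiplying the expression
by `s1 * t3 * y4 * c1` turns it into a positive term minus a negative one. -/
theorem linear_combination_ne_zero {s1 s2 t3 t4 y1 y2 y3 y4 c1 c2 c3 c4 : ℝ}
    (hs : 0 < s1 * s2) (ht : 0 < t3 * t4) (hy1 : y1 * y2 < 0) (hy3 : y3 * y4 < 0)
    (hc1 : c1 * c2 < 0) (hc3 : c3 * c4 < 0) (hyc : (y1 * y3) * (c1 * c3) < 0) :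
    t3 * y4 * (s2 * c1 - s1 * c2) - s1 * y2 * (t4 * c3 - t3 * c4) ≠ 0 := by
  intro h
  have hs1 : s1 ≠ 0 := by rintro rfl; simp at hs
  have ht3 : t3 ≠ 0 := by rintro rfl; simp at ht
  have h4 : y4 ≠ 0 := by rintro rfl; simp at hy3
  have h13 : y1 * y3 ≠ 0 := fun h0 => by simp [h0] at hyc
  have hc0 : c1 ≠ 0 := by rintro rfl; simp at hc1
  have e1 : y2 * y4 * (c1 * c3) < 0 := by
    have : (y1 * y3) ^ 2 * (y2 * y4 * (c1 * c3)) < 0 := by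
      have := mul_neg_of_pos_of_neg (mul_pos_of_neg_of_neg hy1 hy3) hyc
      linarith
    by_contra hX
    have := mul_nonneg (sq_nonneg (y1 * y3)) (not_lt.1 hX)
    linarith
  have e2 : 0 < y2 * y4 * (c1 * c4) := by
    have : (c3) ^ 2 * (y2 * y4 * (c1 * c4)) = (y2 * y4 * (c1 * c3)) * (c3 * c4) := by ring
    have h2 := mul_pos_of_neg_of_neg e1 hc3
    rw [← this] at h2
    exact pos_of_mul_pos_right h2 (sq_nonneg _)
  have l1 : 0 < t3 ^ 2 * y4 ^ 2 * ((s1 * s2) * c1 ^ 2 - s1 ^ 2 * (c1 * c2)) := by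
    have := mul_pos hs (by positivity : 0 < c1 ^ 2)
    have := mul_neg_of_pos_of_neg (by positivity : 0 < s1 ^ 2) hc1
    exact mul_pos (by positivity) (by linarith)
  have l2 : s1 ^ 2 * ((y2 * y4 * (c1 * c3)) * (t3 * t4) - t3 ^ 2 * (y2 * y4 * (c1 * c4))) < 0 := by
    have := mul_neg_of_neg_of_pos e1 ht
    have := mul_pos (by positivity : 0 < t3 ^ 2) e2
    exact mul_neg_of_pos_of_neg (by positivity) (by linarith)
  have : t3 ^ 2 * y4 ^ 2 * ((s1 * s2) * c1 ^ 2 - s1 ^ 2 * (c1 * c2)) -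
      s1 ^ 2 * ((y2 * y4 * (c1 * c3)) * (t3 * t4) - t3 ^ 2 * (y2 * y4 * (c1 * c4))) =
      (t3 * y4 * (s2 * c1 - s1 * c2) - s1 * y2 * (t4 * c3 - t3 * c4)) * (s1 * t3 * y4 * c1) := by
    ring
  rw [h] at this
  linarith

/-- In a realizable orientation, a dimension `a` that is not influenced by `b` influences `b` iff
it influences all the dimensions influenced by `b`. -/
theorem IsRealizable.adj_iff_adj {n : ℕ} {o : Finset (Fin n) → Finset (Fin n)}
    {G : Digraph (Fin n)} (hr : IsRealizable o) (hG : HasInfluenceGraph o G)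
    (hl : ∀ d, G.Adj d d) {a b c : Fin n} (hca : c ≠ a) (hcb : c ≠ b)
    (hbc : G.Adj b c) (hba : ¬ G.Adj b a) : G.Adj a b ↔ G.Adj a c := by
  obtain ⟨M, q, -, hn, hi⟩ := hr
  have hab : a ≠ b := by rintro rfl; exact hba (hl _)
  have e1 : (∅ : Finset (Fin n)) ∆ {b} = {b} := by rw [← Finset.bot_eq_empty, bot_symmDiff]
  have e2 : (∅ : Finset (Fin n)) ∆ {a} = {a} := by rw [← Finset.bot_eq_empty, bot_symmDiff]
  have e3 : ({a} : Finset (Fin n)) ∆ {b} = {a, b} := by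
    rw [← Finset.insert_eq_symmDiff (by simpa using hab.symm), Finset.pair_comm]
  obtain ⟨w1, z1, h1, -, p1⟩ := hi.candidate hn ∅
  obtain ⟨w2, z2, h2, m2, p2⟩ := hi.candidate hn {b}
  obtain ⟨w3, z3, h3, m3, p3⟩ := hi.candidate hn {a}
  obtain ⟨w4, z4, h4, m4, p4⟩ := hi.candidate hn {a, b}
  have i1 := fun d => hG.mem_symmDiff_singleton ∅ b d
  have i2 := fun d => hG.mem_symmDiff_singleton ∅ a d
  have i3 := fun d => hG.mem_symmDiff_singleton {a} b d
  rw [e1] at i1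
  rw [e2] at i2
  rw [e3] at i3
  obtain ⟨-, s1, s1'⟩ := p1 a (by simp)
  obtain ⟨-, y1, y1'⟩ := p1 b (by simp)
  obtain ⟨-, c1, c1'⟩ := p1 c (by simp)
  obtain ⟨-, s2, s2'⟩ := p2 a (by simpa using hab)
  obtain ⟨y20, y2, y2'⟩ := m2 b (by simp)
  obtain ⟨-, c2, c2'⟩ := p2 c (by simpa using hcb)
  obtain ⟨t30, t3, t3'⟩ := m3 a (by simp)
  obtain ⟨-, y3, y3'⟩ := p3 b (by simpa using hab.symm)
  obtain ⟨-, c3, c3'⟩ := p3 c (by simpa using hca)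
  obtain ⟨t40, t4, t4'⟩ := m4 a (by simp)
  obtain ⟨y40, y4, y4'⟩ := m4 b (by simp)
  obtain ⟨-, c4, c4'⟩ := p4 c (by simp [hca, hcb])
  by_contra hcon
  -- The sign hypotheses encode that `b` does not influence `a` but influences `b` and `c`. The last
  -- one encodes that `a` influences exactly one of `b` and `c`, which is the negation of the claim.
  have key := linear_combination_ne_zero
    (mul_pos_of_sign_iff s1 s2 s1' s2' ((i1 a).2 hba).symm)
    (mul_pos_of_sign_iff t3 t4 t3' t4' ((i3 a).2 hba).symm)
    (mul_neg_of_sign_iff y1 y2 y1' y2' fun h => (i1 b).1 h.symm (hl b))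
    (mul_neg_of_sign_iff y3 y4 y3' y4' fun h => (i3 b).1 h.symm (hl b))
    (mul_neg_of_sign_iff c1 c2 c1' c2' fun h => (i1 c).1 h.symm hbc)
    (mul_neg_of_sign_iff c3 c4 c3' c4' fun h => (i3 c).1 h.symm hbc) (by
      by_cases hadj : G.Adj a b
      · have hac : ¬ G.Adj a c := fun h => hcon ⟨fun _ => h, fun _ => hadj⟩
        exact mul_neg_of_neg_of_pos
          (mul_neg_of_sign_iff y1 y3 y1' y3' fun h => (i2 b).1 h.symm hadj)
          (mul_pos_of_sign_iff c1 c3 c1' c3' ((i2 c).2 hac).symm)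
      · have hac : G.Adj a c := by
          by_contra h
          exact hcon ⟨fun h' => absurd h' hadj, fun h' => absurd h' h⟩
        exact mul_neg_of_pos_of_neg (mul_pos_of_sign_iff y1 y3 y1' y3' ((i2 b).2 hadj).symm)
          (mul_neg_of_sign_iff c1 c3 c1' c3' fun h => (i2 c).1 h.symm hac))
  have hz1 : z1 = 0 := funext fun i => (p1 i (by simp)).1
  -- The coefficients are chosen so that the `z`-parts cancel at `a` and at `b`, the only
  -- coordinates where they can be nonzero. Since `w = q + M z`, the same combination of the
  -- `w`-parts is then a multiple of `q`, whatever `M` is.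
  have hz : (z3 a * z4 b * w2 a) • z1 - (z3 a * z4 b * w1 a) • z2 -
      ((w1 a * z2 b * z4 a) • z3 - (w1 a * z2 b * z3 a) • z4) = 0 := by
    funext i
    simp only [Pi.sub_apply, Pi.smul_apply, smul_eq_mul, hz1, Pi.zero_apply]
    by_cases hia : i = a
    · subst hia
      rw [(p2 i (by simpa using hab)).1]
      ring
    · rw [(p3 i (by simpa using hia)).1]
      by_cases hib : i = b
      · subst hib; ring
      · rw [(p2 i (by simpa using hib)).1, (p4 i (by simp [hia, hib])).1]
        ring
  have hw : ∀ i, z3 a * z4 b * (w2 a * w1 i - w1 a * w2 i) -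
      w1 a * z2 b * (z4 a * w3 i - z3 a * w4 i) =
      (z3 a * z4 b * (w2 a - w1 a) - w1 a * z2 b * (z4 a - z3 a)) * q i := by
    intro i
    have := congrFun (congrArg (M *ᵥ ·) hz) i
    simp only [Matrix.mulVec_sub, Matrix.mulVec_smul, Matrix.mulVec_zero, Pi.sub_apply,
      Pi.smul_apply, smul_eq_mul, Pi.zero_apply] at this
    rw [h1 i, h2 i, h3 i, h4 i]
    linear_combination this
  have hq : w1 a = q a := by rw [h1 a, hz1]; simp
  -- At the coordinate `a` the combination vanishes while `q a = w1 a ≠ 0`. The multiple of `q` is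
  -- therefore zero, against `key` at the coordinate `c`.
  have ha := hw a
  rw [t30, t40] at ha
  have hτ : (z3 a * z4 b * (w2 a - w1 a) - w1 a * z2 b * (z4 a - z3 a)) * q a = 0 := by
    rw [← ha]; ring
  rcases mul_eq_zero.1 hτ with h0 | h0
  · exact key (by rw [hw c, h0, zero_mul])
  · exact s1 (hq.trans h0)

/-- Strict orders in which the predecessors of every element form a chain. -/
structure IsForestOrder {ι : Type*} (R : ι → ι → Prop) : Prop where
  irrefl : ∀ a, ¬ R a a
  trans : ∀ a b c, R a b → R b c → R a c
  total : ∀ a b c, R a c → R b c → a ≠ b → R a b ∨ R b a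

/-- The strict part of the influence graph of a realizable orientation is a forest order. -/
theorem IsRealizable.isForestOrder {n : ℕ} {o : Finset (Fin n) → Finset (Fin n)}
    {G : Digraph (Fin n)} (hr : IsRealizable o) (hG : HasInfluenceGraph o G)
    (hl : IsLoopedAcyclic G) : IsForestOrder fun a b => a ≠ b ∧ G.Adj a b := by
  have asymm : ∀ a b, a ≠ b → G.Adj a b → ¬ G.Adj b a := fun a b hab h h' =>
    hl.2 a (.tail (.single ⟨hab, h⟩) ⟨hab.symm, h'⟩)
  refine ⟨fun a h => h.1 rfl, ?_, ?_⟩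
  · rintro a b c ⟨hab, h1⟩ ⟨hbc, h2⟩
    have hac : a ≠ c := by rintro rfl; exact asymm _ _ hab h1 h2
    exact ⟨hac, (hr.adj_iff_adj hG hl.1 hac.symm hbc.symm h2 (asymm _ _ hab h1)).1 h1⟩
  · rintro a b c ⟨hac, h1⟩ ⟨hbc, h2⟩ hab
    by_cases hba : G.Adj b a
    · exact .inr ⟨hab.symm, hba⟩
    · exact .inl ⟨hab, (hr.adj_iff_adj hG hl.1 hac.symm hbc.symm h2 hba).2 h1⟩

/-- Distinct powers of 4 below `4 ^ k` sum to at most `(4 ^ k - 1) / 3`. The factor 3 is the room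
needed when the intervals are packed. -/
theorem three_mul_sum_four_pow_lt {ι : Type*} {h : ι → ℕ} (hh : Function.Injective h)
    (S : Finset ι) (k : ℕ) (hS : ∀ i ∈ S, h i < k) : 3 * ∑ i ∈ S, (4 : ℝ) ^ h i < 4 ^ k := by
  have h1 : ∑ i ∈ S, (4 : ℝ) ^ h i ≤ ∑ j ∈ Finset.range k, (4 : ℝ) ^ j := by
    rw [← Finset.sum_image (f := fun j => (4 : ℝ) ^ j) hh.injOn]
    refine Finset.sum_le_sum_of_subset_of_nonneg ?_ fun _ _ _ => by positivity
    intro j hj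
    obtain ⟨i, hi, rfl⟩ := Finset.mem_image.1 hj
    exact Finset.mem_range.2 (hS i hi)
  have h2 := geom_sum_mul (4 : ℝ) k
  linarith

/-- Every finite forest order is the inclusion order of a family of nested or disjoint
intervals. -/
theorem IsForestOrder.exists_intervals {n : ℕ} {R : Fin n → Fin n → Prop} (hR : IsForestOrder R) :
    ∃ l r : Fin n → ℝ, (∀ d, l d < r d) ∧ (∀ d e, R d e → l d < l e ∧ r e < r d) ∧
      ∀ d e, d ≠ e → ¬ R d e → ¬ R e d → r d < l e ∨ r e < l d := by
  classical
  -- `A d` consists of `d` and its predecessors. The height `h` counts successors, with the index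
  -- breaking ties, so it is injective and decreases along `R`. The interval of `d` starts at the
  -- sum of `4 ^ h f` over `A d` and has length `4 ^ h d`.
  let desc : Fin n → Finset (Fin n) := fun d => Finset.univ.filter (R d)
  let A : Fin n → Finset (Fin n) := fun d => Finset.univ.filter fun e => e = d ∨ R e d
  let h : Fin n → ℕ := fun d => (desc d).card * n + d
  have hinj : Function.Injective h := by
    intro d e hde
    have := congrArg (· % n) hde
    simp only [h, Nat.mul_add_mod_self_right, Nat.mod_eq_of_lt d.2, Nat.mod_eq_of_lt e.2] at this
    exact Fin.ext this
  have hlt : ∀ d e, R d e → h e < h d := by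
    intro d e hde
    have hc : (desc e).card < (desc d).card := by
      refine Finset.card_lt_card ⟨fun x hx => ?_, fun hsub => ?_⟩
      · simp only [desc, Finset.mem_filter, Finset.mem_univ, true_and] at hx ⊢
        exact hR.trans _ _ _ hde hx
      · have : e ∈ desc e := hsub (by simpa [desc] using hde)
        exact hR.irrefl e (by simpa [desc] using this)
    have he := e.2
    calc h e < (desc e).card * n + n := by simp only [h]; omega
      _ = ((desc e).card + 1) * n := by ring
      _ ≤ (desc d).card * n := Nat.mul_le_mul_right _ hc
      _ ≤ h d := Nat.le_add_right _ _
  have hpos : ∀ k, (0 : ℝ) < 4 ^ k := fun k => by positivity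
  -- If the highest element `f` of the symmetric difference of `A d` and `A e` lies in `A d`, its
  -- power outweighs all of `A e \ A d` together with the length of the interval of `e`; that
  -- interval then ends before the one of `d` starts.
  have hdisj : ∀ d e f, f ∈ A d → f ∉ A e → e ∉ A d → (∀ x ∈ A e \ A d, h x < h f) →
      ∑ f ∈ A e, (4 : ℝ) ^ h f + 4 ^ h e < ∑ f ∈ A d, (4 : ℝ) ^ h f := by
    intro d e f hf hf' he hmax
    have hs1 := Finset.sum_sdiff_sub_sum_sdiff (s₁ := A e) (s₂ := A d)
      (f := fun x => (4 : ℝ) ^ h x)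
    have h1 := three_mul_sum_four_pow_lt hinj (A e \ A d) (h f) hmax
    have h2 : (4 : ℝ) ^ h f ≤ ∑ x ∈ A d \ A e, (4 : ℝ) ^ h x :=
      Finset.single_le_sum (f := fun x => (4 : ℝ) ^ h x) (fun x _ => (hpos _).le)
        (Finset.mem_sdiff.2 ⟨hf, hf'⟩)
    have h3 : (4 : ℝ) ^ h e ≤ ∑ x ∈ A e \ A d, (4 : ℝ) ^ h x :=
      Finset.single_le_sum (f := fun x => (4 : ℝ) ^ h x) (fun x _ => (hpos _).le)
        (Finset.mem_sdiff.2 ⟨by simp [A], he⟩)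
    have := hpos (h e)
    linarith
  refine ⟨fun d => ∑ f ∈ A d, 4 ^ h f, fun d => ∑ f ∈ A d, 4 ^ h f + 4 ^ h d,
    fun d => by linarith [hpos (h d)], fun d e hde => ?_, fun d e hne hde hed => ?_⟩
  · have hsub : A d ⊆ A e := by
      intro x hx
      simp only [A, Finset.mem_filter, Finset.mem_univ, true_and] at hx ⊢
      rcases hx with rfl | hx
      · exact .inr hde
      · exact .inr (hR.trans _ _ _ hx hde)
    have hsum := Finset.sum_sdiff (f := fun x => (4 : ℝ) ^ h x) hsub
    have he : e ∈ A e \ A d := by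
      simp only [A, Finset.mem_sdiff, Finset.mem_filter, Finset.mem_univ, true_and, true_or,
        not_or]
      refine ⟨?_, fun hed => hR.irrefl _ (hR.trans _ _ _ hde hed)⟩
      rintro rfl
      exact hR.irrefl _ hde
    -- The chain condition enters here: a predecessor of `e` that is neither `d` nor a predecessor
    -- of `d` is comparable with `d`, hence a successor of `d` and lower than it.
    have h1 := three_mul_sum_four_pow_lt hinj (A e \ A d) (h d) (by
      intro x hx
      simp only [A, Finset.mem_sdiff, Finset.mem_filter, Finset.mem_univ, true_and,
        not_or] at hx
      rcases hx.1 with rfl | hxe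
      · exact hlt _ _ hde
      · rcases hR.total _ _ _ hxe hde hx.2.1 with h' | h'
        · exact absurd h' hx.2.2
        · exact hlt _ _ h')
    have h3 : (4 : ℝ) ^ h e ≤ ∑ x ∈ A e \ A d, (4 : ℝ) ^ h x :=
      Finset.single_le_sum (f := fun x => (4 : ℝ) ^ h x) (fun x _ => (hpos _).le) he
    have := hpos (h e)
    constructor <;> linarith
  · have hdA : d ∉ A e := by simp [A, hne, hde]
    have heA : e ∉ A d := by simp [A, hne.symm, hed]
    obtain ⟨f, hf, hmax⟩ := Finset.exists_max_image ((A d \ A e) ∪ (A e \ A d)) h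
      ⟨d, by simp only [Finset.mem_union, Finset.mem_sdiff]; exact .inl ⟨by simp [A], hdA⟩⟩
    rcases Finset.mem_union.1 hf with hf | hf <;> rw [Finset.mem_sdiff] at hf
    · refine .inr (hdisj d e f hf.1 hf.2 heA fun x hx => ?_)
      refine lt_of_le_of_ne (hmax x (Finset.mem_union_right _ hx)) (hinj.ne ?_)
      rintro rfl
      exact hf.2 (Finset.mem_sdiff.1 hx).1
    · refine .inl (hdisj e d f hf.1 hf.2 hdA fun x hx => ?_)
      refine lt_of_le_of_ne (hmax x (Finset.mem_union_left _ hx)) (hinj.ne ?_)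
      rintro rfl
      exact hf.2 (Finset.mem_sdiff.1 hx).1

/-! ### Operations on oriented matroids of vector configurations -/

section Operations

variable {E E' : Type*} {r : ℕ}

theorem OrientedMatroid.reorient_injective [DecidableEq E] (F : Finset E) :
    Function.Injective fun M : OrientedMatroid E => M.reorient F := by
  intro M M' h
  ext X
  have := congrArg (fun M => flip F X ∈ M.circuits) h
  simpa [reorient, flip_flip] using this

theorem OrientedMatroid.relabel_injective (π : E ≃ E') :
    Function.Injective fun M : OrientedMatroid E => M.relabel π := by
  intro M M' h
  ext X
  have := congrArg (fun M => X ∘ π.symm ∈ M.circuits) h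
  simpa [relabel, Function.comp_assoc] using this

/-- Minimality depends only on which vectors are dependencies and on their supports; `T` matches
both up to the bijection `π`. -/
theorem isMinimalDependency_transport [Fintype E] [Fintype E'] {W : Matrix (Fin r) E ℝ}
    {V : Matrix (Fin r) E' ℝ} {T : (E → ℝ) → E' → ℝ} (hT : Function.Surjective T)
    (hV : ∀ y, V *ᵥ T y = W *ᵥ y) (π : E ≃ E')
    (hs : ∀ y, Function.support (T y) = π '' Function.support y) (y : E → ℝ) :
    IsMinimalDependency V (T y) ↔ IsMinimalDependency W y := by
  have h0 : ∀ y, T y = 0 ↔ y = 0 := fun y => by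
    rw [← Function.support_eq_empty_iff, hs, Set.image_eq_empty, Function.support_eq_empty_iff]
  simp only [IsMinimalDependency, hV, ne_eq, h0]
  refine and_congr_right fun _ => and_congr_right fun _ => ⟨fun h z hz hz0 hsub => ?_,
    fun h z hz hz0 hsub => ?_⟩
  · refine h (T z) (by rwa [h0]) (by rwa [hV]) ?_
    rw [hs, hs]
    exact π.injective.image_strictMono hsub
  · obtain ⟨z, rfl⟩ := hT z
    rw [hs, hs] at hsub
    replace hsub : Function.support z ⊂ Function.support y :=
      ⟨(Set.image_subset_image_iff π.injective).1 hsub.1, fun h => hsub.2 (Set.image_mono h)⟩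
    exact h z (by rwa [← h0]) (by rwa [← hV]) hsub

/-- Multiplying the dependency coordinates by `s e` turns dependencies of the scaled columns into
dependencies of the original ones. On signs this flips exactly the elements with `s e < 0`. -/
theorem OrientedMatroid.relabel_reorient_ofMatrix [Fintype E] [DecidableEq E] [Fintype E']
    (V : Matrix (Fin r) E' ℝ) (π : E ≃ E') (s : E → ℝ) (hs : ∀ e, s e ≠ 0) :
    ((ofMatrix (Matrix.of fun k e => s e * V k (π e))).reorient
      (Finset.univ.filter fun e => s e < 0)).relabel π = ofMatrix V := by
  let T : (E → ℝ) → E' → ℝ := fun y e => s (π.symm e) * y (π.symm e)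
  have hT : Function.Surjective T := fun z => ⟨fun e => (s e)⁻¹ * z (π e), by
    funext e
    simp [T, hs]⟩
  have hmin := isMinimalDependency_transport (V := V)
    (W := Matrix.of fun k e => s e * V k (π e)) hT (fun y => by
      funext k
      simp only [Matrix.mulVec, dotProduct, Matrix.of_apply, T]
      refine (Fintype.sum_equiv π _ _ fun e => ?_).symm
      simp only [Equiv.symm_apply_apply]
      ring) π (fun y => by
      ext e
      simp only [T, Function.mem_support, ne_eq, mul_eq_zero, hs, false_or, Set.mem_image]
      exact ⟨fun h => ⟨_, h, by simp⟩, by rintro ⟨e, h, rfl⟩; simpa using h⟩)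
  have hsign : ∀ y, signVector (T y) ∘ π =
      flip (Finset.univ.filter fun e => s e < 0) (signVector y) := by
    intro y
    funext e
    simp only [signVector, Function.comp_apply, T, Equiv.symm_apply_apply, sign_mul, flip,
      Finset.mem_filter, Finset.mem_univ, true_and]
    rcases lt_or_gt_of_ne (hs e) with h | h
    · simp [h]
    · simp [h, h.not_gt]
  ext X
  simp only [relabel, reorient, ofMatrix, Set.mem_ofPred_eq]
  constructor
  · rintro ⟨y, hy, hX⟩
    refine ⟨T y, (hmin y).2 hy, ?_⟩
    have h1 := congrArg (flip (Finset.univ.filter fun e => s e < 0)) hX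
    rw [flip_flip, ← hsign] at h1
    funext e
    simpa using congrFun h1 (π.symm e)
  · rintro ⟨z, hz, rfl⟩
    obtain ⟨y, rfl⟩ := hT z
    exact ⟨y, (hmin y).1 hz, by rw [hsign, flip_flip]⟩

/-- Dependencies of the remaining columns are the dependencies that vanish at `none`. Anything with
support inside such a vector vanishes there too, so minimality is the same on both sides. -/
theorem OrientedMatroid.deletion_ofMatrix [Fintype E] (V : Matrix (Fin r) (Option E) ℝ) :
    (ofMatrix V).deletion = ofMatrix (V.submatrix id some) := by
  have hmul : ∀ x : Option E → ℝ, x none = 0 →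
      V.submatrix id some *ᵥ (fun e => x (some e)) = V *ᵥ x := fun x hx => by
    funext k
    simp [Matrix.mulVec, dotProduct, Fintype.sum_option, hx]
  have hmem : ∀ x y : Option E → ℝ, x none = 0 → y none = 0 →
      (Function.support x ⊂ Function.support y ↔
        Function.support (fun e => x (some e)) ⊂ Function.support (fun e => y (some e))) := by
    intro x y hx hy
    simp only [Set.ssubset_iff_subset_ne, Set.subset_def, ne_eq, Set.ext_iff, Option.forall,
      Function.mem_support, hx, hy, not_true, true_and, false_imp_iff]
  ext X
  simp only [deletion, ofMatrix, Set.mem_ofPred_eq]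
  constructor
  · rintro ⟨x, hx, hX⟩
    have hx0 : x none = 0 := by
      exact sign_eq_zero_iff.1 (congrFun hX none).symm
    refine ⟨fun e => x (some e), ⟨fun h => hx.1 ?_, by rw [hmul x hx0, hx.2.1],
      fun y hy hVy hsub => ?_⟩, funext fun e => congrFun hX (some e)⟩
    · funext e
      cases e with
      | none => exact hx0
      | some e => exact congrFun h e
    · refine hx.2.2 (fun e => e.elim 0 y) (fun h => hy (funext fun e => congrFun h (some e))) ?_
        ((hmem _ _ rfl hx0).2 hsub)
      rw [← hmul _ rfl]
      exact hVy
  · rintro ⟨x, hx, rfl⟩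
    refine ⟨fun e => e.elim 0 x, ⟨fun h => hx.1 (funext fun e => congrFun h (some e)), ?_,
      fun y hy hVy hsub => ?_⟩, ?_⟩
    · rw [← hmul _ rfl]
      exact hx.2.1
    · have hy0 : y none = 0 := by
        by_contra h
        exact hsub.1 h rfl
      refine hx.2.2 (fun e => y (some e)) (fun h => hy ?_) (by rw [hmul y hy0, hVy])
        ((hmem _ _ hy0 rfl).1 hsub)
      funext e
      cases e with
      | none => exact hy0
      | some e => exact congrFun h e
    · funext e
      cases e <;> simp [extendZero, signVector]

end Operations

/-! ### Uniform vector configurations -/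

section Uniform

variable {E : Type*} {n : ℕ}

/-- The determinant of the columns of `V` selected by `σ`. -/
noncomputable def bracket (V : Matrix (Fin n) E ℝ) (σ : Fin n → E) : ℝ := (V.submatrix id σ).det

/-- All maximal minors are nonzero. -/
def IsUniformConfiguration (V : Matrix (Fin n) E ℝ) : Prop :=
  ∀ σ : Fin n → E, Function.Injective σ → bracket V σ ≠ 0

theorem updateCol_submatrix [DecidableEq E] (V : Matrix (Fin n) E ℝ) (σ : Fin n → E) (i : Fin n)
    (e : E) : (V.submatrix id σ).updateCol i (fun k => V k e) =
      V.submatrix id (Function.update σ i e) := by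
  ext k j
  by_cases h : j = i
  · subst h; simp
  · simp [h]

theorem Matrix.det_mul_eq_det_updateCol (A : Matrix (Fin n) (Fin n) ℝ) {y b : Fin n → ℝ}
    (h : A *ᵥ y = b) (i : Fin n) : A.det * y i = (A.updateCol i b).det := by
  rw [← Matrix.cramer_apply, Matrix.cramer_eq_adjugate_mulVec, ← h, Matrix.mulVec_mulVec,
    Matrix.adjugate_mul, Matrix.smul_mulVec, Matrix.one_mulVec, Pi.smul_apply, smul_eq_mul]

/-- Cramer's rule for expressing the negative of column `e` in the columns `σ`. It is the source of
every sign read off from brackets, for circuits and for LCP solutions alike. -/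
theorem bracket_mul_eq [DecidableEq E] (V : Matrix (Fin n) E ℝ) {σ : Fin n → E} {y : Fin n → ℝ}
    {e : E} (h : V.submatrix id σ *ᵥ y = -fun k => V k e) (i : Fin n) :
    bracket V σ * y i = -bracket V (Function.update σ i e) := by
  rw [bracket, Matrix.det_mul_eq_det_updateCol _ h, ← neg_one_smul ℝ (fun k => V k e),
    Matrix.det_updateCol_smul, updateCol_submatrix, bracket, neg_one_mul]

theorem submatrix_mulVec_comp [Fintype E] (V : Matrix (Fin n) E ℝ) {σ : Fin n → E}
    (hσ : Function.Injective σ) (y : E → ℝ) (hy : Function.support y ⊆ Set.range σ) :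
    V.submatrix id σ *ᵥ (y ∘ σ) = V *ᵥ y := by
  funext k
  refine Fintype.sum_of_injective σ hσ _ _ (fun e he => ?_) fun i => rfl
  have : y e = 0 := by
    by_contra h
    exact he (hy h)
  simp [this]

theorem Finset.exists_injective_range_eq {T : Finset E} (hT : T.card = n) :
    ∃ σ : Fin n → E, Function.Injective σ ∧ Set.range σ = T :=
  ⟨fun i => (T.equivFinOfCardEq hT).symm i,
    Subtype.val_injective.comp (T.equivFinOfCardEq hT).symm.injective, by
      rw [← Function.comp_def, EquivLike.range_comp]
      simp⟩

theorem IsUniformConfiguration.lt_ncard_support [Fintype E] {V : Matrix (Fin n) E ℝ}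
    (hV : IsUniformConfiguration V) (hE : n ≤ Fintype.card E) {y : E → ℝ} (hy : y ≠ 0)
    (hVy : V *ᵥ y = 0) : n < (Function.support y).ncard := by
  classical
  by_contra! hle
  rw [Set.ncard_eq_toFinset_card'] at hle
  obtain ⟨T, hsub, hT⟩ := Finset.exists_superset_card_eq hle hE
  obtain ⟨σ, hσ, hr⟩ := T.exists_injective_range_eq hT
  have hsub' : Function.support y ⊆ Set.range σ := by
    rw [hr]
    intro e he
    exact hsub (by simpa using he)
  have h0 := Matrix.eq_zero_of_mulVec_eq_zero (hV σ hσ)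
    ((submatrix_mulVec_comp V hσ y hsub').trans hVy)
  refine hy (funext fun e => ?_)
  by_contra he
  obtain ⟨i, rfl⟩ := hsub' he
  exact he (congrFun h0 i)

theorem Function.Injective.update_of_notMem_range {α β : Type*} [DecidableEq α] {σ : α → β}
    (hσ : Function.Injective σ) (i : α) {e : β} (he : e ∉ Set.range σ) :
    Function.Injective (Function.update σ i e) := by
  intro a b hab
  by_cases ha : a = i <;> by_cases hb : b = i
  · rw [ha, hb]
  · subst ha
    rw [Function.update_self, Function.update_of_ne hb] at hab
    exact absurd ⟨b, hab.symm⟩ he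
  · subst hb
    rw [Function.update_self, Function.update_of_ne ha] at hab
    exact absurd ⟨a, hab⟩ he
  · rw [Function.update_of_ne ha, Function.update_of_ne hb] at hab
    exact hσ hab

/-- The circuit of a uniform configuration with support `insert e (range σ)`. -/
theorem IsUniformConfiguration.exists_circuit [Fintype E] [DecidableEq E]
    {V : Matrix (Fin n) E ℝ} (hV : IsUniformConfiguration V) {σ : Fin n → E}
    (hσ : Function.Injective σ) {e : E} (he : e ∉ Set.range σ) :
    ∃ C ∈ (OrientedMatroid.ofMatrix V).circuits, C e = 1 ∧
      (∀ i, C (σ i) = -SignType.sign (bracket V (Function.update σ i e) * bracket V σ)) ∧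
      (∀ j, j ≠ e → j ∉ Set.range σ → C j = 0) ∧
      ∀ X ∈ (OrientedMatroid.ofMatrix V).circuits, signSupport X ⊆ insert e (Set.range σ) →
        X = C ∨ X = -C := by
  have hdet := hV σ hσ
  have hE : n + 1 ≤ Fintype.card E := by
    have := Finset.card_le_univ (insert e (Finset.univ.image σ))
    rwa [Finset.card_insert_of_notMem (by simpa using he), Finset.card_image_of_injective _ hσ,
      Finset.card_univ, Fintype.card_fin] at this
  set A := V.submatrix id σ with hA
  set y : Fin n → ℝ := A⁻¹ *ᵥ -fun k => V k e with hy
  have hAy : A *ᵥ y = -fun k => V k e := by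
    rw [hy, Matrix.mulVec_mulVec, Matrix.mul_nonsing_inv _ (isUnit_iff_ne_zero.2 hdet),
      Matrix.one_mulVec]
  let x : E → ℝ := Pi.single e 1 + ∑ i, y i • Pi.single (σ i) 1
  have hxe : x e = 1 := by
    simp only [x, Pi.add_apply, Finset.sum_apply, Pi.smul_apply, smul_eq_mul, Pi.single_eq_same]
    rw [Finset.sum_eq_zero, add_zero]
    intro i _
    rw [Pi.single_eq_of_ne fun h => he ⟨i, h.symm⟩, mul_zero]
  have hxσ : ∀ i, x (σ i) = y i := by
    intro i
    simp only [x, Pi.add_apply, Finset.sum_apply, Pi.smul_apply, smul_eq_mul]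
    rw [Pi.single_eq_of_ne fun h => he ⟨i, h⟩, zero_add, Finset.sum_eq_single i]
    · simp
    · intro j _ hj
      rw [Pi.single_eq_of_ne (hσ.ne hj.symm), mul_zero]
    · simp
  have hx0 : ∀ j, j ≠ e → j ∉ Set.range σ → x j = 0 := by
    intro j hj hjσ
    simp only [x, Pi.add_apply, Finset.sum_apply, Pi.smul_apply, smul_eq_mul]
    rw [Pi.single_eq_of_ne hj, zero_add]
    exact Finset.sum_eq_zero fun i _ => by
      rw [Pi.single_eq_of_ne fun h => hjσ ⟨i, h.symm⟩, mul_zero]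
  have hVx : V *ᵥ x = 0 := by
    have h1 := submatrix_mulVec_comp V hσ (x - Pi.single e 1) (by
      intro j hj
      by_contra hjσ
      by_cases hje : j = e
      · subst hje; simp [hxe] at hj
      · simp [hje, hx0 j hje hjσ] at hj)
    have h2 : (x - Pi.single e 1) ∘ σ = y := by
      funext i
      simp [hxσ, Pi.single_eq_of_ne fun h => he ⟨i, h⟩]
    rw [h2, hAy, Matrix.mulVec_sub] at h1
    have h3 : V *ᵥ Pi.single e 1 = fun k => V k e := by
      funext k; simp
    rw [h3] at h1
    exact sub_eq_neg_self.1 h1.symm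
  have hyi : ∀ i, y i = -(bracket V (Function.update σ i e) / bracket V σ) := by
    intro i
    rw [← neg_div, eq_div_iff hdet, mul_comm]
    exact bracket_mul_eq V hAy i
  have hsupp : Function.support x ⊆ insert e (Set.range σ) := by
    intro j hj
    by_contra h
    rw [Set.mem_insert_iff, not_or] at h
    exact hj (hx0 j h.1 h.2)
  -- The support of `x` has at most `n + 1` elements, while every nonzero dependency needs more than
  -- `n`; none can be strictly smaller.
  have hx : IsMinimalDependency V x := by
    refine ⟨fun h => by simp [h] at hxe, hVx, fun z hz hVz hsub => ?_⟩
    have h1 := hV.lt_ncard_support (by omega) hz hVz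
    have h2 := Set.ncard_lt_ncard hsub (Set.toFinite _)
    have h3 := (Set.ncard_le_ncard hsupp (Set.toFinite _)).trans (Set.ncard_insert_le _ _)
    rw [← Set.image_univ, Set.ncard_image_of_injective _ hσ, Set.ncard_univ, Nat.card_fin] at h3
    omega
  have hC : signVector x ∈ (OrientedMatroid.ofMatrix V).circuits := ⟨x, hx, rfl⟩
  refine ⟨signVector x, hC, by simp [signVector, hxe], fun i => ?_, fun j hj hjσ => by
    simp [signVector, hx0 j hj hjσ], fun X hX hsub => ?_⟩
  · simp only [signVector, hxσ, hyi, Left.sign_neg, div_eq_mul_inv, sign_mul]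
    congr 2
    rcases lt_or_gt_of_ne hdet with h | h <;> simp [h]
  · refine (OrientedMatroid.ofMatrix V).incomparable X hX _ hC (hsub.trans ?_)
    rw [signSupport_signVector]
    rintro j (rfl | ⟨i, rfl⟩)
    · simp [hxe]
    · rw [Function.mem_support, hxσ, hyi]
      exact neg_ne_zero.2 (div_ne_zero (hV _ (hσ.update_of_notMem_range i he)) hdet)

theorem IsUniformConfiguration.lt_ncard_signSupport [Fintype E] {V : Matrix (Fin n) E ℝ}
    (hV : IsUniformConfiguration V) (hE : n ≤ Fintype.card E) {X : E → SignType}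
    (hX : X ∈ (OrientedMatroid.ofMatrix V).circuits) : n < (signSupport X).ncard := by
  obtain ⟨x, hx, rfl⟩ := hX
  rw [signSupport_signVector]
  exact hV.lt_ncard_support hE hx.1 hx.2.1

/-- Any further element `x` closes a circuit inside `insert x B`, so `B` is maximal. -/
theorem IsUniformConfiguration.isBasis [Fintype E] [DecidableEq E] {V : Matrix (Fin n) E ℝ}
    (hV : IsUniformConfiguration V) (hE : n ≤ Fintype.card E) {B : Set E} (hB : B.ncard = n) :
    (OrientedMatroid.ofMatrix V).IsBasis B := by
  classical
  refine ⟨fun C hC hsub => ?_, fun A hA hBA x hx => ?_⟩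
  · have := hV.lt_ncard_signSupport hE hC
    have := Set.ncard_le_ncard hsub (Set.toFinite _)
    omega
  · by_contra hxB
    obtain ⟨σ, hσ, hr⟩ := B.toFinset.exists_injective_range_eq
      (by rw [← Set.ncard_eq_toFinset_card', hB])
    rw [Set.coe_toFinset] at hr
    obtain ⟨C, hC, -, -, h0, -⟩ := hV.exists_circuit hσ (e := x) (by rwa [hr])
    refine hA C hC fun j hj => ?_
    by_cases hjx : j = x
    · rwa [hjx]
    · by_contra hjA
      exact hj (h0 j hjx fun hjr => hjA (hBA (hr ▸ hjr)))

end Uniform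

/-! ### P-matroids and associated orientations of uniform configurations -/

section Configurations

variable {n : ℕ}

/-- The elements of the complementary set of the vertex `v`. -/
def vertexSelection (v : Finset (Fin n)) (i : Fin n) : PGround n :=
  if i ∈ v then Sum.inr i else Sum.inl i

theorem elim_vertexSelection (v : Finset (Fin n)) (i : Fin n) :
    Sum.elim id id (vertexSelection v i) = i := by
  unfold vertexSelection
  split <;> rfl

theorem vertexSelection_injective (v : Finset (Fin n)) :
    Function.Injective (vertexSelection v) := fun i j h => by
  rw [← elim_vertexSelection v i, h, elim_vertexSelection]

theorem range_vertexSelection (v : Finset (Fin n)) :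
    Set.range (vertexSelection v) = vertexBasis v := by
  ext (i | i)
  · refine ⟨fun ⟨j, hj⟩ => ?_, fun h => ⟨i, if_neg h⟩⟩
    have hji : j = i := by rw [← elim_vertexSelection v j, hj]; rfl
    subst hji
    intro hv
    simp [vertexSelection, hv] at hj
  · refine ⟨fun ⟨j, hj⟩ => ?_, fun h => ⟨i, if_pos h⟩⟩
    have hji : j = i := by rw [← elim_vertexSelection v j, hj]; rfl
    subst hji
    by_contra hv
    have hv' : j ∉ v := hv
    simp [vertexSelection, hv'] at hj

theorem vertexSelection_symmDiff_singleton (v : Finset (Fin n)) (i : Fin n) :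
    vertexSelection (v ∆ {i}) =
      Function.update (vertexSelection v) i (vertexSelection v i).swap := by
  funext j
  by_cases hj : j = i
  · subst hj
    by_cases hv : j ∈ v <;> simp [vertexSelection, hv, Finset.mem_symmDiff]
  · simp [vertexSelection, hj, Finset.mem_symmDiff]

theorem swap_vertexSelection_notMem_range (v : Finset (Fin n)) (i : Fin n) :
    (vertexSelection v i).swap ∉ Set.range (vertexSelection v) := by
  rintro ⟨j, hj⟩
  have hji : j = i := by
    rw [← elim_vertexSelection v j, hj]
    by_cases hv : i ∈ v <;> simp [vertexSelection, hv]
  subst hji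
  by_cases hv : j ∈ v <;> simp [vertexSelection, hv] at hj

/-- The determinants belonging to adjacent vertices have opposite signs. -/
def IsAlternatingConfiguration (V : Matrix (Fin n) (PGround n) ℝ) : Prop :=
  ∀ v i, bracket V (vertexSelection v) * bracket V (vertexSelection (v ∆ {i})) < 0

/-- The circuit in the basis of `v` enlarged by the complement of its `i`-th element has `i` as its
only complementary pair. Its signs on that pair compare the determinants at the two ends of an edge.
-/
theorem IsUniformConfiguration.exists_circuit_pair {V : Matrix (Fin n) (PGround n) ℝ}
    (hV : IsUniformConfiguration V) (v : Finset (Fin n)) (i : Fin n) :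
    ∃ C ∈ (OrientedMatroid.ofMatrix V).circuits,
      C (vertexSelection v i).swap = 1 ∧
      C (vertexSelection v i) = -SignType.sign
        (bracket V (vertexSelection v) * bracket V (vertexSelection (v ∆ {i}))) ∧
      (∀ j, j ≠ i → C (vertexSelection v j).swap = 0) ∧
      ∀ X ∈ (OrientedMatroid.ofMatrix V).circuits,
        signSupport X ⊆ insert (vertexSelection v i).swap (Set.range (vertexSelection v)) →
        X = C ∨ X = -C := by
  obtain ⟨C, hC, h1, h2, h3, h4⟩ := hV.exists_circuit (vertexSelection_injective v)
    (swap_vertexSelection_notMem_range v i)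
  refine ⟨C, hC, h1, ?_, fun j hj => h3 _ (fun h => hj ?_)
    (swap_vertexSelection_notMem_range v j), h4⟩
  · rw [h2, ← vertexSelection_symmDiff_singleton, mul_comm]
  · exact vertexSelection_injective v (Sum.swap_leftInverse.injective h)

theorem SignType.neg_sign_eq_one_iff (x : ℝ) : -SignType.sign x = 1 ↔ x < 0 := by
  rw [neg_eq_iff_eq_neg, sign_eq_neg_one_iff]

/-- The oriented matroid of a uniform configuration is a P-matroid iff the determinants of adjacent
vertices have opposite signs. -/
theorem IsUniformConfiguration.isPMatroid_iff {V : Matrix (Fin n) (PGround n) ℝ}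
    (hV : IsUniformConfiguration V) :
    IsPMatroid (OrientedMatroid.ofMatrix V) ↔ IsAlternatingConfiguration V := by
  have hE : n ≤ Fintype.card (PGround n) := by simp
  constructor
  · rintro ⟨-, -, h⟩ v i
    obtain ⟨C, hC, h1, h2, h3, -⟩ := hV.exists_circuit_pair v i
    rw [← SignType.neg_sign_eq_one_iff, ← h2, ← h1]
    by_contra hne
    have hi : C (vertexSelection v i) ≠ 0 := by
      rw [h2]
      intro h0
      exact mul_ne_zero (hV _ (vertexSelection_injective _)) (hV _ (vertexSelection_injective _))
        (sign_eq_zero_iff.1 ((neg_eq_iff_eq_neg.1 h0).trans (by decide)))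
    refine h ⟨C, hC, i, fun j => ?_, ?_⟩
    · by_cases hj : j = i
      · subst hj
        by_cases hv : j ∈ v <;> simp_all [vertexSelection, signSupport]
      · have := h3 j hj
        by_cases hv : j ∈ v <;> simp_all [vertexSelection, signSupport]
    · by_cases hv : i ∈ v
      · simpa [vertexSelection, hv, eq_comm] using hne
      · simpa [vertexSelection, hv] using hne
  · intro h
    refine ⟨hV.isBasis hE ?_, fun B hB _ => hV.isBasis hE hB, ?_⟩
    · rw [← Set.image_univ, Set.ncard_image_of_injective _ Sum.inl_injective, Set.ncard_univ,
        Nat.card_fin]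
    · classical
      rintro ⟨C, hC, i, hi, hne⟩
      -- Away from `i` the support of `C` contains at most one element of each pair; `v` selects it,
      -- so the basis of `v` together with the pair `i` contains the support.
      let v : Finset (Fin n) := Finset.univ.filter fun j => j ≠ i ∧ C (Sum.inr j) ≠ 0
      obtain ⟨C', -, h1, h2, -, h4⟩ := hV.exists_circuit_pair v i
      rw [(SignType.neg_sign_eq_one_iff _).2 (h v i)] at h2
      have hv : vertexSelection v i = Sum.inl i := by simp [vertexSelection, v]
      rw [hv] at h1 h2
      have hsub : signSupport C ⊆
          insert (vertexSelection v i).swap (Set.range (vertexSelection v)) := by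
        rw [hv, range_vertexSelection]
        rintro (j | j) hj
        · refine .inr ?_
          change j ∉ v
          have := (hi j).1
          simp only [v, Finset.mem_filter, Finset.mem_univ, true_and, not_and, not_not]
          intro hji
          by_contra hr
          exact hji (this ⟨hj, hr⟩)
        · by_cases hji : j = i
          · exact .inl (by simp [hji])
          · refine .inr ?_
            change j ∈ v
            simpa [v, hji, signSupport] using hj
      rcases h4 C hC hsub with rfl | rfl
      · exact hne (h2.trans h1.symm)
      · exact hne (congrArg Neg.neg (h2.trans h1.symm))

/-- The orientation associated with a uniform configuration in terms of determinants. -/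
theorem IsUniformConfiguration.isAssociatedOrientation_iff
    {V : Matrix (Fin n) (Option (PGround n)) ℝ} (hV : IsUniformConfiguration V)
    (u : Finset (Fin n) → Finset (Fin n)) :
    IsAssociatedOrientation (OrientedMatroid.ofMatrix V) u ↔
      ∀ v i, i ∈ u v ↔ 0 < bracket V (Function.update (some ∘ vertexSelection v) i none) *
        bracket V (some ∘ vertexSelection v) := by
  refine forall_congr' fun v => ?_
  have hinj : Function.Injective (some ∘ vertexSelection v) :=
    (Option.some_injective _).comp (vertexSelection_injective v)
  obtain ⟨C, hC, h1, h2, h3, h4⟩ := hV.exists_circuit hinj (e := none) (by simp)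
  have hr : Set.range (some ∘ vertexSelection v) = some '' vertexBasis v := by
    rw [Set.range_comp, range_vertexSelection]
  have hsign : ∀ i, (C (some (Sum.inl i)) = -1 ∨ C (some (Sum.inr i)) = -1) ↔
      0 < bracket V (Function.update (some ∘ vertexSelection v) i none) *
        bracket V (some ∘ vertexSelection v) := by
    intro i
    have h5 := h2 i
    have h6 := h3 (some (vertexSelection v i).swap) (by simp) (by
      rintro ⟨j, hj⟩
      exact swap_vertexSelection_notMem_range v i ⟨j, Option.some_injective _ hj⟩)
    rw [← sign_eq_one_iff, ← neg_inj (a := SignType.sign _), ← h5]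
    by_cases hv : i ∈ v
    · simp only [vertexSelection, hv, if_true, Sum.swap_inr, Function.comp_apply] at h6 ⊢
      simp [h6]
    · simp only [vertexSelection, hv, if_false, Sum.swap_inl, Function.comp_apply] at h6 ⊢
      simp [h6]
  constructor
  · rintro ⟨X, ⟨hX, hsub, hX1⟩, hu⟩
    rw [← hr] at hsub
    rcases h4 X hX hsub with rfl | rfl
    · exact fun i => (hu i).trans (hsign i)
    · rw [Pi.neg_apply, h1] at hX1
      exact absurd hX1 (by decide)
  · intro hu
    refine ⟨C, ⟨hC, fun j hj => ?_, h1⟩, fun i => (hu i).trans (hsign i).symm⟩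
    by_contra hcon
    rw [← hr, Set.mem_insert_iff, not_or] at hcon
    exact hj (h3 j hcon.1 hcon.2)

/-- Each edge of the cube flips the sign of the determinant, so the sign at `s` relative to `∅` is
the parity of `s`. This becomes positivity of the principal minors. -/
theorem IsAlternatingConfiguration.bracket_sign {V : Matrix (Fin n) (PGround n) ℝ}
    (hV : IsAlternatingConfiguration V) (h0 : bracket V (vertexSelection ∅) ≠ 0)
    (s : Finset (Fin n)) :
    0 < bracket V (vertexSelection ∅) * ((-1) ^ s.card * bracket V (vertexSelection s)) := by
  induction s using Finset.induction_on with
  | empty =>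
    rw [Finset.card_empty, pow_zero, one_mul]
    exact mul_self_pos.2 h0
  | insert e s he ih =>
    have h := hV s e
    rw [← Finset.insert_eq_symmDiff he] at h
    rw [Finset.card_insert_of_notMem he, pow_succ]
    have h2 := mul_pos_of_neg_of_neg h (neg_lt_zero.2 ih)
    have h3 : bracket V (vertexSelection s) ≠ 0 := left_ne_zero_of_mul h.ne
    refine pos_of_mul_pos_right (a := bracket V (vertexSelection s) ^ 2) ?_ (sq_nonneg _)
    linarith

/-- The columns outside `s` are unit vectors, so the matrix is block triangular with an identity
block. -/
theorem Matrix.det_ite_column (M : Matrix (Fin n) (Fin n) ℝ) (s : Finset (Fin n)) :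
    (Matrix.of fun i j => if j ∈ s then -M i j else (1 : Matrix (Fin n) (Fin n) ℝ) i j).det =
      (-1) ^ s.card * (M.submatrix (fun i : s => (i : Fin n)) (fun i : s => (i : Fin n))).det := by
  rw [Matrix.twoBlockTriangular_det' _ (· ∈ s)]
  · have h1 : (Matrix.of fun i j => if j ∈ s then -M i j else
        (1 : Matrix (Fin n) (Fin n) ℝ) i j).toSquareBlockProp (· ∈ s) =
        -(M.submatrix (fun i : s => (i : Fin n)) (fun i : s => (i : Fin n))) := by
      ext i j
      simp [Matrix.toSquareBlockProp, j.2]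
    have h2 : (Matrix.of fun i j => if j ∈ s then -M i j else
        (1 : Matrix (Fin n) (Fin n) ℝ) i j).toSquareBlockProp (fun i => ¬ i ∈ s) = 1 := by
      ext i j
      simp [Matrix.toSquareBlockProp, j.2, Matrix.one_apply, Subtype.ext_iff]
    rw [h1, h2, Matrix.det_one, mul_one]
    have h3 := Matrix.det_neg (M.submatrix (fun i : s => (i : Fin n)) (fun i : s => (i : Fin n)))
    rw [Fintype.card_coe] at h3
    convert h3
  · intro i hi j hj
    simp only [Matrix.of_apply, hj, if_false]
    exact Matrix.one_apply_ne fun h => hj (h ▸ hi)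

/-- Let `A` and `C` hold the columns of the elements `i` and of their complements, and let `b` be
minus the column of `q`. Multiplying `A w + C z = b` by `A⁻¹` gives the LCP with `M = -A⁻¹ C` and
right-hand side `A⁻¹ b`. Its candidate at `B` solves the system in the columns selected by `B`, so
`w + z` lists the coefficients of the fundamental circuit of `q`. -/
theorem isRealizable_of_configuration {V : Matrix (Fin n) (Option (PGround n)) ℝ}
    (hV : IsUniformConfiguration V) (hP : IsAlternatingConfiguration (V.submatrix id some))
    {u : Finset (Fin n) → Finset (Fin n)}
    (hu : ∀ v i, i ∈ u v ↔ 0 < bracket V (Function.update (some ∘ vertexSelection v) i none) *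
        bracket V (some ∘ vertexSelection v)) : IsRealizable u := by
  have hinj : ∀ v : Finset (Fin n), Function.Injective (some ∘ vertexSelection v) := fun v =>
    (Option.some_injective _).comp (vertexSelection_injective v)
  set A : Matrix (Fin n) (Fin n) ℝ := V.submatrix id (some ∘ Sum.inl) with hA
  set C : Matrix (Fin n) (Fin n) ℝ := V.submatrix id (some ∘ Sum.inr) with hC
  set b : Fin n → ℝ := -fun k => V k none with hb
  have hempty : A.det = bracket V (some ∘ vertexSelection ∅) := by
    simp [bracket, hA, vertexSelection, Function.comp_def]
  have hAdet : IsUnit A.det := isUnit_iff_ne_zero.2 (hempty ▸ hV _ (hinj ∅))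
  -- candidate solutions in terms of the complementary columns
  have hcols : ∀ (B : Finset (Fin n)) (w z : Fin n → ℝ), (∀ i ∈ B, w i = 0) →
      (∀ i ∉ B, z i = 0) →
      (w - (-(A⁻¹ * C)) *ᵥ z = A⁻¹ *ᵥ b ↔
        V.submatrix id (some ∘ vertexSelection B) *ᵥ (w + z) = b) := by
    intro B w z hw hz
    have h1 : V.submatrix id (some ∘ vertexSelection B) *ᵥ (w + z) = A *ᵥ w + C *ᵥ z := by
      funext k
      simp only [Matrix.mulVec, dotProduct, Pi.add_apply, ← Finset.sum_add_distrib]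
      refine Finset.sum_congr rfl fun i _ => ?_
      by_cases hi : i ∈ B
      · simp [hA, hC, vertexSelection, hi, hw i hi]
      · simp [hA, hC, vertexSelection, hi, hz i hi]
    have h2 : A *ᵥ (w - (-(A⁻¹ * C)) *ᵥ z) = A *ᵥ w + C *ᵥ z := by
      rw [Matrix.neg_mulVec, sub_neg_eq_add, Matrix.mulVec_add, Matrix.mulVec_mulVec,
        ← Matrix.mul_assoc, Matrix.mul_nonsing_inv _ hAdet, Matrix.one_mul]
    rw [h1, ← h2]
    constructor
    · intro h
      rw [h, Matrix.mulVec_mulVec, Matrix.mul_nonsing_inv _ hAdet, Matrix.one_mulVec]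
    · intro h
      rw [← h, Matrix.mulVec_mulVec, Matrix.nonsing_inv_mul _ hAdet, Matrix.one_mulVec]
  refine ⟨-(A⁻¹ * C), A⁻¹ *ᵥ b, fun s => ?_, fun B w z h i hi => ?_, fun B => ?_⟩
  · have h1 := hP.bracket_sign (hV _ (hinj ∅)) s
    -- The columns selected by `s` are `A` times the matrix with columns `-M j` for `j ∈ s` and unit
    -- vectors otherwise.
    have h2 : bracket (V.submatrix id some) (vertexSelection s) = A.det * ((-1) ^ s.card *
        ((-(A⁻¹ * C)).submatrix (fun i : s => (i : Fin n)) (fun i : s => (i : Fin n))).det) := by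
      rw [← Matrix.det_ite_column, ← Matrix.det_mul, bracket]
      congr 1
      have h3 : A * (A⁻¹ * C) = C := by
        rw [← Matrix.mul_assoc, Matrix.mul_nonsing_inv _ hAdet, Matrix.one_mul]
      ext k j
      by_cases hj : j ∈ s
      · have := congrFun (congrFun h3 k) j
        simp only [Matrix.mul_apply, Matrix.of_apply, hj, if_true, Matrix.neg_apply,
          neg_neg] at this ⊢
        rw [this]
        simp [hC, vertexSelection, hj]
      · have := congrFun (congrFun (Matrix.mul_one A) k) j
        rw [Matrix.mul_apply] at this ⊢
        simp only [Matrix.of_apply, hj, if_false]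
        rw [this]
        simp [hA, vertexSelection, hj]
    have h4 : bracket (V.submatrix id some) (vertexSelection ∅) = A.det := hempty.symm
    rw [h2, h4] at h1
    have h5 : ((-1 : ℝ) ^ s.card) * (-1) ^ s.card = 1 := by
      rw [← mul_pow]; norm_num
    refine pos_of_mul_pos_right (a := A.det ^ 2) ?_ (sq_nonneg _)
    linear_combination h1 + A.det ^ 2 * (((-(A⁻¹ * C)).submatrix (fun i : s => (i : Fin n))
      (fun i : s => (i : Fin n))).det) * h5
  -- If both `w i` and `z i` were zero, Cramer's rule would make the determinant with `q` in place
  -- `i` vanish, against uniformity.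
  · have h1 := bracket_mul_eq V ((hcols B w z h.2.1 h.2.2).1 h.1) i
    rw [Pi.add_apply, hi.1, hi.2, add_zero, mul_zero, eq_comm, neg_eq_zero] at h1
    exact hV _ ((hinj B).update_of_notMem_range i (by simp)) h1
  · have hdet := hV _ (hinj B)
    set x : Fin n → ℝ := (V.submatrix id (some ∘ vertexSelection B))⁻¹ *ᵥ b with hx
    have hBx : V.submatrix id (some ∘ vertexSelection B) *ᵥ x = b := by
      rw [hx, Matrix.mulVec_mulVec, Matrix.mul_nonsing_inv _ (isUnit_iff_ne_zero.2 hdet),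
        Matrix.one_mulVec]
    have hw : ∀ i ∈ B, (fun i => if i ∈ B then 0 else x i) i = 0 := fun i hi => by simp [hi]
    have hz : ∀ i ∉ B, (fun i => if i ∈ B then x i else 0) i = 0 := fun i hi => by simp [hi]
    have hwz : ((fun i => if i ∈ B then 0 else x i) + fun i => if i ∈ B then x i else 0) = x := by
      funext i
      by_cases hi : i ∈ B <;> simp [hi]
    refine ⟨_, _, ⟨(hcols B _ _ hw hz).2 (by rw [hwz, hBx]), hw, hz⟩, fun i => ?_⟩
    have h1 := bracket_mul_eq V hBx i
    have h2 : bracket V (Function.update (some ∘ vertexSelection B) i none) ≠ 0 :=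
      hV _ ((hinj B).update_of_notMem_range i (by simp))
    have h3 : x i ≠ 0 := by
      intro h0
      rw [h0, mul_zero, eq_comm, neg_eq_zero] at h1
      exact h2 h1
    have h4 : i ∈ u B ↔ x i ≤ 0 := by
      rw [hu, ← neg_neg (bracket V (Function.update _ i none)), ← h1]
      have h5 : 0 < bracket V (some ∘ vertexSelection B) ^ 2 := by positivity
      constructor
      · intro h
        by_contra! hpos
        have := mul_pos h5 hpos
        linarith
      · intro h
        have := mul_neg_of_pos_of_neg h5 (lt_of_le_of_ne h h3)
        linarith
    by_cases hi : i ∈ B <;> simp [hi, h4]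

end Configurations

/-! ### Points on the moment curve -/

section MomentCurve

variable {n : ℕ} {E : Type*}

theorem mul_neg_iff_of_pos_left {a b : ℝ} (ha : 0 < a) : a * b < 0 ↔ b < 0 :=
  ⟨fun h => by_contra fun hb => h.not_ge (mul_nonneg ha.le (not_lt.1 hb)),
    mul_neg_of_pos_of_neg ha⟩

/-- As a function of a single node, the Vandermonde determinant is the product of the differences to
the other nodes, up to a factor that does not involve this node. -/
theorem Matrix.det_vandermonde_update (f : Fin n → ℝ) (d : Fin n) :
    ∃ K, ∀ a, (Matrix.vandermonde (Function.update f d a)).det =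
      K * ∏ j ∈ Finset.univ.erase d, (f j - a) := by
  -- The sign reverses the factors `a - f i` with `i < d`; the double product collects the factors
  -- not involving `d`.
  refine ⟨(-1) ^ (Finset.Iio d).card * ∏ i, ∏ j ∈ Finset.Ioi i,
    if i ≠ d ∧ j ≠ d then f j - f i else 1, fun a => ?_⟩
  have h0 : ∀ i, ∀ j ∈ Finset.Ioi i, Function.update f d a j - Function.update f d a i =
      (if j = d then -1 * (f i - a) else 1) * ((if i = d then f j - a else 1) *
        (if i ≠ d ∧ j ≠ d then f j - f i else 1)) := by
    intro i j hij
    have hne : i ≠ j := (Finset.mem_Ioi.1 hij).ne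
    by_cases hj : j = d
    · subst hj
      simp [hne]
    · by_cases hi : i = d
      · subst hi
        simp [hj]
      · simp [hi, hj]
  have h1 : ∏ i, ∏ j ∈ Finset.Ioi i, (if j = d then -1 * (f i - a) else 1) =
      (-1) ^ (Finset.Iio d).card * ∏ i ∈ Finset.Iio d, (f i - a) := by
    simp only [Finset.prod_ite_eq', Finset.mem_Ioi]
    rw [← Finset.prod_filter, ← Finset.prod_const, ← Finset.prod_mul_distrib]
    exact Finset.prod_congr (by ext; simp) fun _ _ => rfl
  have h2 : ∏ i, ∏ j ∈ Finset.Ioi i, (if i = d then f j - a else 1) =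
      ∏ j ∈ Finset.Ioi d, (f j - a) := by
    rw [Finset.prod_eq_single d]
    · simp
    · intro i _ hi
      simp [hi]
    · simp
  have h3 : Finset.univ.erase d = Finset.Iio d ∪ Finset.Ioi d := by
    ext j
    simp [lt_or_lt_iff_ne]
  rw [Matrix.det_vandermonde, Finset.prod_congr rfl fun i _ => Finset.prod_congr rfl (h0 i)]
  simp only [Finset.prod_mul_distrib] at h1 ⊢
  rw [h3, Finset.prod_union (Finset.disjoint_left.2 fun j h h' => by
    rw [Finset.mem_Iio] at h; rw [Finset.mem_Ioi] at h'; exact absurd h h'.not_gt)]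
  rw [h1, h2]
  ring

/-- The vectors `s e • (1, t e, …, (t e) ^ (n - 1))`. -/
def momentConfiguration (n : ℕ) (s t : E → ℝ) : Matrix (Fin n) E ℝ :=
  Matrix.of fun k e => s e * t e ^ (k : ℕ)

theorem bracket_momentConfiguration (s t : E → ℝ) (σ : Fin n → E) :
    bracket (momentConfiguration n s t) σ =
      (∏ i, s (σ i)) * (Matrix.vandermonde (t ∘ σ)).det := by
  rw [← Matrix.det_transpose (Matrix.vandermonde _), ← Matrix.det_mul_row]
  rfl

theorem isUniformConfiguration_moment {s t : E → ℝ} (hs : ∀ e, s e ≠ 0)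
    (ht : Function.Injective t) : IsUniformConfiguration (momentConfiguration n s t) := by
  intro σ hσ
  rw [bracket_momentConfiguration]
  exact mul_ne_zero (Finset.prod_ne_zero_iff.2 fun i _ => hs _)
    (Matrix.det_vandermonde_ne_zero_iff.2 (ht.comp hσ))

/-- The common factor of two determinants differing only in column `d` appears squared. The sign of
their product is thus decided by the scalings and by how many of the other points lie between `t e`
and `t e'`. -/
theorem exists_bracket_update_mul [DecidableEq E] {s t : E → ℝ} (hs : ∀ e, s e ≠ 0)
    (ht : Function.Injective t) {σ : Fin n → E} (hσ : Function.Injective σ) (d : Fin n) :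
    ∃ c > 0, ∀ e e', bracket (momentConfiguration n s t) (Function.update σ d e) *
      bracket (momentConfiguration n s t) (Function.update σ d e') =
        c * (s e * s e' * ∏ j ∈ Finset.univ.erase d, ((t (σ j) - t e) * (t (σ j) - t e'))) := by
  obtain ⟨K, hK⟩ := Matrix.det_vandermonde_update (t ∘ σ) d
  have h : ∀ e, bracket (momentConfiguration n s t) (Function.update σ d e) =
      (K * ∏ j ∈ Finset.univ.erase d, s (σ j)) *
        (s e * ∏ j ∈ Finset.univ.erase d, (t (σ j) - t e)) := by
    intro e
    rw [bracket_momentConfiguration, Function.comp_update, hK,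
      ← Finset.mul_prod_erase _ _ (Finset.mem_univ d), Function.update_self,
      Finset.prod_congr rfl fun j hj => by rw [Function.update_of_ne (Finset.ne_of_mem_erase hj)]]
    simp only [Function.comp_apply]
    ring
  refine ⟨(K * ∏ j ∈ Finset.univ.erase d, s (σ j)) ^ 2, ?_, fun e e' => ?_⟩
  · have h1 := isUniformConfiguration_moment hs ht σ hσ
    rw [← Function.update_eq_self d σ, h] at h1
    have := left_ne_zero_of_mul h1
    positivity
  · rw [h, h, Finset.prod_mul_distrib]
    ring

/-! ### The influence graph of points on the moment curve -/

/-- Negative iff `t e` lies between the two points of the pair `d`. -/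
def pairSign (t : Option (PGround n) → ℝ) (d : Fin n) (e : Option (PGround n)) : ℝ :=
  (t e - t (some (Sum.inl d))) * (t e - t (some (Sum.inr d)))

theorem pairSign_ne_zero {t : Option (PGround n) → ℝ} (ht : Function.Injective t) {d : Fin n}
    {e : Option (PGround n)} (h1 : e ≠ some (Sum.inl d)) (h2 : e ≠ some (Sum.inr d)) :
    pairSign t d e ≠ 0 :=
  mul_ne_zero (sub_ne_zero.2 (ht.ne h1)) (sub_ne_zero.2 (ht.ne h2))

theorem pairSign_vertexSelection_ne_zero {t : Option (PGround n) → ℝ} (ht : Function.Injective t)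
    {d j : Fin n} (hj : j ≠ d) (v : Finset (Fin n)) :
    pairSign t d (some (vertexSelection v j)) ≠ 0 := by
  refine pairSign_ne_zero ht ?_ ?_ <;> by_cases hv : j ∈ v <;> simp [vertexSelection, hv, hj]

section

variable {s t : Option (PGround n) → ℝ}

theorem exists_bracket_swap_mul (hs : ∀ e, s e ≠ 0) (ht : Function.Injective t)
    {σ : Fin n → Option (PGround n)} (hσ : Function.Injective σ) (v : Finset (Fin n)) (d : Fin n)
    (hd : σ d = some (vertexSelection v d)) :
    ∃ c > 0, bracket (momentConfiguration n s t) σ * bracket (momentConfiguration n s t)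
      (Function.update σ d (some (vertexSelection v d).swap)) =
        c * (s (some (Sum.inl d)) * s (some (Sum.inr d)) *
          ∏ j ∈ Finset.univ.erase d, pairSign t d (σ j)) := by
  obtain ⟨c, hc, h⟩ := exists_bracket_update_mul hs ht hσ d
  refine ⟨c, hc, ?_⟩
  have h1 := h (σ d) (some (vertexSelection v d).swap)
  rw [Function.update_eq_self] at h1
  rw [h1, hd]
  by_cases hv : d ∈ v
  · simp only [vertexSelection, hv, if_true, Sum.swap_inr, pairSign]
    rw [mul_comm (s _)]
    simp only [mul_comm (t _ - t (some (Sum.inl d)))]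
  · simp only [vertexSelection, hv, if_false, Sum.swap_inl, pairSign]

theorem some_comp_vertexSelection_injective (v : Finset (Fin n)) :
    Function.Injective (some ∘ vertexSelection v) :=
  (Option.some_injective _).comp (vertexSelection_injective v)

theorem some_comp_vertexSelection_symmDiff (v : Finset (Fin n)) (d : Fin n) :
    some ∘ vertexSelection (v ∆ {d}) =
      Function.update (some ∘ vertexSelection v) d (some (vertexSelection v d).swap) := by
  rw [vertexSelection_symmDiff_singleton, Function.comp_update]

theorem isAlternatingConfiguration_moment_iff (hs : ∀ e, s e ≠ 0) (ht : Function.Injective t) :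
    IsAlternatingConfiguration ((momentConfiguration n s t).submatrix id some) ↔
      ∀ v d, s (some (Sum.inl d)) * s (some (Sum.inr d)) *
        ∏ j ∈ Finset.univ.erase d, pairSign t d (some (vertexSelection v j)) < 0 := by
  refine forall_congr' fun v => forall_congr' fun d => ?_
  obtain ⟨c, hc, h⟩ := exists_bracket_swap_mul hs ht (some_comp_vertexSelection_injective v) v d rfl
  rw [← some_comp_vertexSelection_symmDiff] at h
  change bracket (momentConfiguration n s t) (some ∘ vertexSelection v) *
    bracket (momentConfiguration n s t) (some ∘ vertexSelection (v ∆ {d})) < 0 ↔ _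
  rw [h]
  exact mul_neg_iff_of_pos_left hc

/-- The pairs of a P-matroid form a non-crossing matching. -/
theorem IsAlternatingConfiguration.noncrossing (hs : ∀ e, s e ≠ 0) (ht : Function.Injective t)
    (h : IsAlternatingConfiguration ((momentConfiguration n s t).submatrix id some))
    {d i : Fin n} (hdi : i ≠ d) :
    0 < pairSign t d (some (Sum.inl i)) * pairSign t d (some (Sum.inr i)) := by
  rw [isAlternatingConfiguration_moment_iff hs ht] at h
  -- At the vertices `∅` and `{i}` the two negative products differ only in the factor of `i`, so
  -- the two points of the pair `i` have the same sign with respect to the pair `d`.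
  have h1 := h ∅ d
  have h2 := h {i} d
  have hi : i ∈ Finset.univ.erase d := by simp [hdi]
  rw [← Finset.mul_prod_erase _ _ hi] at h1 h2
  have h3 : ∏ j ∈ (Finset.univ.erase d).erase i, pairSign t d (some (vertexSelection {i} j)) =
      ∏ j ∈ (Finset.univ.erase d).erase i, pairSign t d (some (vertexSelection ∅ j)) :=
    Finset.prod_congr rfl fun j hj => by
      simp [vertexSelection, Finset.ne_of_mem_erase hj]
  rw [h3] at h2
  simp only [vertexSelection, Finset.notMem_empty, if_false, Finset.mem_singleton, if_true]
    at h1 h2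
  have h4 := mul_pos_of_neg_of_neg h1 h2
  refine pos_of_mul_pos_right (a := (s (some (Sum.inl d)) * s (some (Sum.inr d)) *
    ∏ j ∈ (Finset.univ.erase d).erase i, pairSign t d (some (Sum.inl j))) ^ 2) ?_ (sq_nonneg _)
  linarith

theorem xor_pos_iff {a b : ℝ} (ha : a ≠ 0) (hb : b ≠ 0) : Xor (0 < a) (0 < b) ↔ a * b < 0 := by
  rw [xor_iff_not_iff, mul_neg_iff]
  rcases lt_or_gt_of_ne ha with h1 | h1 <;> rcases lt_or_gt_of_ne hb with h2 | h2 <;>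
    simp [h1, h2, h1.not_gt, h2.not_gt]

/-- The graph with an edge from `d` to `i` iff the pair `d` separates the pair `i` from the
additional point. -/
def separationGraph (t : Option (PGround n) → ℝ) : Digraph (Fin n) where
  Adj d i := d = i ∨ pairSign t d (some (Sum.inl i)) * pairSign t d none < 0

/-- Crossing dimension `d` changes membership of `i` iff the product of the four determinants
involved is negative. For `d = i` the determinant containing `q` occurs squared and the P-property
decides. For `d ≠ i` the swap of `d` is compared with and without `q` in place `i`: up to a positive
factor there remain the pair signs of the `i`-th point and of `q`. -/
theorem IsAlternatingConfiguration.hasInfluenceGraph (hs : ∀ e, s e ≠ 0)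
    (ht : Function.Injective t)
    (h : IsAlternatingConfiguration ((momentConfiguration n s t).submatrix id some))
    {u : Finset (Fin n) → Finset (Fin n)}
    (hu : ∀ v i, i ∈ u v ↔
      0 < bracket (momentConfiguration n s t) (Function.update (some ∘ vertexSelection v) i none) *
        bracket (momentConfiguration n s t) (some ∘ vertexSelection v)) :
    HasInfluenceGraph u (separationGraph t) := by
  intro d i v
  have hV := isUniformConfiguration_moment (n := n) hs ht
  have hσ := some_comp_vertexSelection_injective (n := n)
  have hσ' : ∀ v i, Function.Injective (Function.update (some ∘ vertexSelection (n := n) v) i none)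
    := fun v i => (hσ v).update_of_notMem_range i (by simp)
  rw [hu, hu, xor_pos_iff (mul_ne_zero (hV _ (hσ' _ _)) (hV _ (hσ _)))
    (mul_ne_zero (hV _ (hσ' _ _)) (hV _ (hσ _)))]
  by_cases hdi : d = i
  · subst hdi
    have h1 := h v d
    simp only [separationGraph, true_or, iff_true]
    rw [some_comp_vertexSelection_symmDiff, Function.update_idem,
      ← some_comp_vertexSelection_symmDiff]
    have h2 := mul_neg_of_pos_of_neg (pow_pos (abs_pos.2 (hV _ (hσ' v d))) 2) h1
    rw [sq_abs] at h2
    refine lt_of_eq_of_lt ?_ h2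
    change _ = _ * (bracket (momentConfiguration n s t) (some ∘ vertexSelection v) *
      bracket (momentConfiguration n s t) (some ∘ vertexSelection (v ∆ {d})))
    ring
  · obtain ⟨c, hc, h1⟩ := exists_bracket_swap_mul hs ht (hσ v) v d rfl
    obtain ⟨c', hc', h2⟩ := exists_bracket_swap_mul hs ht (hσ' v i) v d
      (by rw [Function.update_of_ne hdi]; rfl)
    have hi : i ∈ Finset.univ.erase d := by simp [Ne.symm hdi]
    rw [Function.update_comm (Ne.symm hdi), ← some_comp_vertexSelection_symmDiff,
      ← Finset.mul_prod_erase _ _ hi, Function.update_self] at h2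
    rw [← some_comp_vertexSelection_symmDiff, ← Finset.mul_prod_erase _ _ hi] at h1
    have h3 : ∏ j ∈ (Finset.univ.erase d).erase i, pairSign t d
          (Function.update (some ∘ vertexSelection v) i none j) =
        ∏ j ∈ (Finset.univ.erase d).erase i, pairSign t d ((some ∘ vertexSelection v) j) :=
      Finset.prod_congr rfl fun j hj => by
        rw [Function.update_of_ne (Finset.ne_of_mem_erase hj)]
    rw [h3] at h2
    set R := ∏ j ∈ (Finset.univ.erase d).erase i, pairSign t d ((some ∘ vertexSelection v) j)
      with hR
    have hR0 : R ≠ 0 := Finset.prod_ne_zero_iff.2 fun j hj =>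
      pairSign_vertexSelection_ne_zero ht (Finset.ne_of_mem_erase (Finset.mem_of_mem_erase hj)) v
    have hpos : 0 < c * c' * (s (some (Sum.inl d)) * s (some (Sum.inr d)) * R) ^ 2 := by
      have := hs (some (Sum.inl d))
      have := hs (some (Sum.inr d))
      positivity
    -- By non-crossing it does not matter which point of the pair `i` the vertex selects.
    have h4 : (pairSign t d ((some ∘ vertexSelection v) i) * pairSign t d none < 0) ↔
        pairSign t d (some (Sum.inl i)) * pairSign t d none < 0 := by
      by_cases hv : i ∈ v
      · simp only [Function.comp_apply, vertexSelection, hv, if_true]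
        have h5 := h.noncrossing hs ht (Ne.symm hdi)
        have h6 := pairSign_ne_zero ht (d := d) (e := none) (by simp) (by simp)
        simp only [mul_neg_iff]
        rw [mul_pos_iff] at h5
        rcases h5 with ⟨h5, h7⟩ | ⟨h5, h7⟩ <;> simp [h5, h7, h5.not_gt, h7.not_gt]
      · simp [vertexSelection, hv]
    simp only [separationGraph, hdi, false_or]
    rw [← h4]
    refine Iff.trans ?_ (mul_neg_iff_of_pos_left hpos)
    refine iff_of_eq (congrArg (· < 0) ?_)
    linear_combination bracket (momentConfiguration n s t) (some ∘ vertexSelection v) *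
      bracket (momentConfiguration n s t) (some ∘ vertexSelection (v ∆ {d})) * h2 +
      c' * (s (some (Sum.inl d)) * s (some (Sum.inr d)) * (pairSign t d none * R)) * h1

end

/-- If `a, a'` separates `b` from `q` and does not cross `b, b'`, everything that `b, b'` separates
from `q` is separated from `q` by `a, a'` as well. After sorting both pairs this is a finite check
of orders on the line. -/
theorem separation_trans {a a' b b' q e : ℝ}
    (h1 : (b - a) * (b - a') * ((q - a) * (q - a')) < 0)
    (h2 : 0 < (b - a) * (b - a') * ((b' - a) * (b' - a')))
    (h3 : (e - b) * (e - b') * ((q - b) * (q - b')) < 0) :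
    (e - a) * (e - a') * ((q - a) * (q - a')) < 0 := by
  wlog ha : a ≤ a' generalizing a a'
  · have := this (a := a') (a' := a) (by linarith) (by linarith) (le_of_not_ge ha)
    linarith
  wlog hb : b ≤ b' generalizing b b'
  · refine this (b := b') (b' := b) (by linarith) ?_ (by linarith) (le_of_not_ge hb)
    rw [mul_neg_iff] at h1 ⊢
    rw [mul_pos_iff] at h2
    rcases h1 with h1 | h1 <;> rcases h2 with h2 | h2
    · exact .inl ⟨h2.2, h1.2⟩
    · exact absurd h1.1 h2.1.not_gt
    · exact absurd h1.1 h2.1.not_gt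
    · exact .inr ⟨h2.2, h1.2⟩
  simp only [mul_neg_iff, mul_pos_iff, sub_pos, sub_neg] at h1 h2 h3 ⊢
  grind

/-- Along an edge from `d` to a different `i`, the set of points separated from `q` shrinks
strictly: a point of the pair `i` is separated by `d`, but its own pair sign is zero. So no directed
cycle can close up. -/
theorem isLoopedAcyclic_separationGraph {t : Option (PGround n) → ℝ}
    (hnc : ∀ d i : Fin n, i ≠ d →
      0 < pairSign t d (some (Sum.inl i)) * pairSign t d (some (Sum.inr i))) :
    IsLoopedAcyclic (separationGraph t) := by
  classical
  let S : Fin n → Finset (Option (PGround n)) := fun d =>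
    Finset.univ.filter fun e => pairSign t d e * pairSign t d none < 0
  have hS : ∀ d i, d ≠ i ∧ (separationGraph t).Adj d i → S i ⊂ S d := by
    rintro d i ⟨hdi, hadj⟩
    have hadj' := hadj.resolve_left hdi
    refine ⟨fun e he => ?_, fun hsub => ?_⟩
    · simp only [S, Finset.mem_filter, Finset.mem_univ, true_and] at he ⊢
      exact separation_trans hadj' (hnc d i hdi.symm) he
    · have : some (Sum.inl i) ∈ S i := hsub (by simpa [S] using hadj')
      replace this := (Finset.mem_filter.1 this).2
      simp [pairSign] at this
  have hT : ∀ d i, Relation.TransGen (fun a b => a ≠ b ∧ (separationGraph t).Adj a b) d i →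
      S i ⊂ S d := by
    intro d i h
    induction h with
    | single h => exact hS _ _ h
    | tail _ h ih => exact (hS _ _ h).trans ih
  exact ⟨fun d => .inl rfl, fun d hd => (hT d d hd).2 (Finset.Subset.refl _)⟩

end MomentCurve

/-! ### Alternating matroids as moment configurations, and the proof of the theorem -/

section Main

variable {n : ℕ}

theorem exists_equiv_strictMono {E : Type*} [Fintype E] {N : ℕ} (hE : Fintype.card E = N)
    {t : E → ℝ} (ht : Function.Injective t) :
    ∃ (π : E ≃ Fin N) (x : Fin N → ℝ), StrictMono x ∧ ∀ e, t e = x (π e) := by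
  classical
  have hT : (Finset.univ.image t).card = N := by
    rw [Finset.card_image_of_injective _ ht, Finset.card_univ, hE]
  let o := (Finset.univ.image t).orderIsoOfFin hT
  let g : E → Fin N := fun e => o.symm ⟨t e, by simp⟩
  have hg : Function.Injective g := fun a b h => ht (congrArg Subtype.val (o.symm.injective h))
  refine ⟨Equiv.ofBijective g ((Fintype.bijective_iff_injective_and_card g).2
    ⟨hg, by rw [hE, Fintype.card_fin]⟩), fun k => o k, fun a b hab => o.strictMono hab,
    fun e => ?_⟩
  simp [g]

/-- Scaled points on the moment curve realize a reorientation and relabeling of the alternating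
matroid. -/
theorem exists_isAlternating {E : Type*} [Fintype E] [DecidableEq E] {N : ℕ}
    (hE : Fintype.card E = N) {s t : E → ℝ} (hs : ∀ e, s e ≠ 0) (ht : Function.Injective t) :
    ∃ (π : E ≃ Fin N) (F : Finset E), IsAlternating n N
      (((OrientedMatroid.ofMatrix (momentConfiguration n s t)).reorient F).relabel π) := by
  obtain ⟨π, x, hx, htx⟩ := exists_equiv_strictMono hE ht
  refine ⟨π, Finset.univ.filter fun e => s e < 0, x, hx, ?_⟩
  rw [← OrientedMatroid.relabel_reorient_ofMatrix (momentMatrix n x) π s hs]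
  congr 3
  ext k e
  simp [momentConfiguration, momentMatrix, htx]

/-- Reorientation and relabeling are injective, so they can be undone on a realization: a sign `-1`
on `F` undoes the flips and composing the positions with `π` undoes the relabeling. -/
theorem eq_ofMatrix_of_isAlternating {E : Type*} [Fintype E] [DecidableEq E] {N : ℕ}
    {M : OrientedMatroid E} {π : E ≃ Fin N} {F : Finset E}
    (h : IsAlternating n N ((M.reorient F).relabel π)) :
    ∃ s t : E → ℝ, (∀ e, s e ≠ 0) ∧ Function.Injective t ∧
      M = OrientedMatroid.ofMatrix (momentConfiguration n s t) := by
  obtain ⟨x, hx, h⟩ := h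
  let s : E → ℝ := fun e => if e ∈ F then -1 else 1
  have hs : ∀ e, s e ≠ 0 := fun e => by by_cases he : e ∈ F <;> simp [s, he]
  refine ⟨s, x ∘ π, hs, hx.injective.comp π.injective, ?_⟩
  have h1 := OrientedMatroid.relabel_reorient_ofMatrix (momentMatrix n x) π s hs
  have hF : (Finset.univ.filter fun e => s e < 0) = F := by
    ext e
    by_cases he : e ∈ F <;> simp [s, he]
  rw [hF] at h1
  exact OrientedMatroid.reorient_injective F
    (OrientedMatroid.relabel_injective π (h.trans h1.symm))

/-- The orientation associated with a simple extension of a cyclic-P-matroid is a realizable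
Matoušek-type USO. -/
theorem IsSimpleExtension.matousekType_and_realizable {M : OrientedMatroid (PGround n)}
    {Mhat : OrientedMatroid (Option (PGround n))} (h : IsSimpleExtension Mhat M)
    {u : Finset (Fin n) → Finset (Fin n)} (hu : IsAssociatedOrientation Mhat u) :
    IsMatousekTypeUSO u ∧ IsRealizable u := by
  obtain ⟨⟨hP, -⟩, hext, π, F, hA⟩ := h
  obtain ⟨s, t, hs, ht, rfl⟩ := eq_ofMatrix_of_isAlternating hA
  have hV := isUniformConfiguration_moment (n := n) hs ht
  have hV' : IsUniformConfiguration ((momentConfiguration n s t).submatrix id some) :=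
    fun σ hσ => hV (some ∘ σ) ((Option.some_injective _).comp hσ)
  rw [IsExtension, OrientedMatroid.deletion_ofMatrix] at hext
  rw [← hext, hV'.isPMatroid_iff] at hP
  rw [hV.isAssociatedOrientation_iff] at hu
  exact ⟨isMatousekTypeUSO_iff.2 ⟨_, isLoopedAcyclic_separationGraph
    fun d i hdi => hP.noncrossing hs ht hdi, hP.hasInfluenceGraph hs ht hu⟩,
    isRealizable_of_configuration hV hP hu⟩

/-- Positions of a family of nested or disjoint intervals, followed by the additional point. -/
theorem IsForestOrder.exists_positions {R : Fin n → Fin n → Prop} (hR : IsForestOrder R) :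
    ∃ t : Option (PGround n) → ℝ, Function.Injective t ∧ (∀ d, 0 < pairSign t d none) ∧
      ∀ d i, d ≠ i → (R d i → pairSign t d (some (Sum.inl i)) < 0 ∧
        pairSign t d (some (Sum.inr i)) < 0) ∧ (¬ R d i → 0 < pairSign t d (some (Sum.inl i)) ∧
        0 < pairSign t d (some (Sum.inr i))) := by
  obtain ⟨l, r, hlr, hnest, hdisj⟩ := hR.exists_intervals
  have hb : ∃ b, ∀ d, r d < b :=
    ⟨∑ d, |r d| + 1, fun d => by
      have := Finset.single_le_sum (f := fun d => |r d|) (fun _ _ => abs_nonneg _)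
        (Finset.mem_univ d)
      have := le_abs_self (r d)
      linarith⟩
  obtain ⟨b, hb⟩ := hb
  have htri : ∀ d i, d ≠ i → (R d i ∧ l d < l i ∧ r i < r d) ∨ (¬ R d i ∧ l i < l d ∧ r d < r i) ∨
      (¬ R d i ∧ r d < l i) ∨ (¬ R d i ∧ r i < l d) := by
    intro d i hdi
    by_cases h1 : R d i
    · exact .inl ⟨h1, hnest _ _ h1⟩
    · by_cases h2 : R i d
      · exact .inr (.inl ⟨h1, hnest _ _ h2⟩)
      · exact .inr (.inr ((hdisj d i hdi h1 h2).imp (fun h => ⟨h1, h⟩) fun h => ⟨h1, h⟩))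
  refine ⟨fun e => e.elim b (Sum.elim l r), ?_, fun d => ?_, fun d i hdi => ?_⟩
  · have hlb : ∀ d, l d < b := fun d => (hlr d).trans (hb d)
    have hne : ∀ d i, d ≠ i → l d ≠ l i ∧ r d ≠ r i ∧ l d ≠ r i := by
      intro d i hdi
      have h1 := hlr d
      have h2 := hlr i
      rcases htri d i hdi with ⟨-, h⟩ | ⟨-, h⟩ | ⟨-, h⟩ | ⟨-, h⟩ <;>
        refine ⟨?_, ?_, ?_⟩ <;> intro heq <;> linarith
    rintro (_ | d | d) (_ | i | i) h <;> simp only [Option.elim, Sum.elim_inl, Sum.elim_inr] at h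
    · rfl
    · exact absurd h (hlb i).ne'
    · exact absurd h (hb i).ne'
    · exact absurd h (hlb d).ne
    · rw [not_imp_not.1 (fun h' => (hne d i h').1) h]
    · by_cases hdi : d = i
      · exact absurd (hdi ▸ h) (hlr d).ne
      · exact absurd h (hne d i hdi).2.2
    · exact absurd h (hb d).ne
    · by_cases hdi : i = d
      · exact absurd (hdi ▸ h.symm) (hlr d).ne
      · exact absurd h.symm (hne i d hdi).2.2
    · rw [not_imp_not.1 (fun h' => (hne d i h').2.1) h]
  · exact mul_pos (sub_pos.2 ((hlr d).trans (hb d))) (sub_pos.2 (hb d))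
  · have h1 := hlr d
    have h2 := hlr i
    simp only [pairSign, Option.elim, Sum.elim_inl, Sum.elim_inr]
    rcases htri d i hdi with ⟨h0, h⟩ | ⟨h0, h⟩ | ⟨h0, h⟩ | ⟨h0, h⟩
    · refine ⟨fun _ => ⟨?_, ?_⟩, fun h' => absurd h0 h'⟩ <;>
        exact mul_neg_of_pos_of_neg (by linarith) (by linarith)
    · refine ⟨fun h' => absurd h' h0, fun _ => ⟨?_, ?_⟩⟩
      · exact mul_pos_of_neg_of_neg (by linarith) (by linarith)
      · exact mul_pos (by linarith) (by linarith)
    · refine ⟨fun h' => absurd h' h0, fun _ => ⟨?_, ?_⟩⟩ <;>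
        exact mul_pos (by linarith) (by linarith)
    · refine ⟨fun h' => absurd h' h0, fun _ => ⟨?_, ?_⟩⟩ <;>
        exact mul_pos_of_neg_of_neg (by linarith) (by linarith)

/-- Every orientation whose influence graph is a forest order comes from points on the moment
curve. -/
theorem HasInfluenceGraph.exists_configuration {u : Finset (Fin n) → Finset (Fin n)}
    {G : Digraph (Fin n)} (hu : HasInfluenceGraph u G) (hl : ∀ d, G.Adj d d)
    (hG : IsForestOrder fun a b => a ≠ b ∧ G.Adj a b) :
    ∃ s t : Option (PGround n) → ℝ, (∀ e, s e ≠ 0) ∧ Function.Injective t ∧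
      IsAlternatingConfiguration ((momentConfiguration n s t).submatrix id some) ∧
      ∀ v i, i ∈ u v ↔
        0 < bracket (momentConfiguration n s t)
            (Function.update (some ∘ vertexSelection v) i none) *
          bracket (momentConfiguration n s t) (some ∘ vertexSelection v) := by
  classical
  obtain ⟨t, ht, hnone, hR⟩ := hG.exists_positions
  -- `θ i` carries the sign of exchanging the point `i` for `q` at the vertex `∅`, before scaling.
  -- The scaling `ε i` corrects it so that `ε i * θ i` is positive exactly for `i ∈ u ∅`.
  let θ : Fin n → ℝ := fun i => ∏ j ∈ Finset.univ.erase i,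
    ((t (some (Sum.inl j)) - t none) * (t (some (Sum.inl j)) - t (some (Sum.inl i))))
  have hθ : ∀ i, θ i ≠ 0 := fun i => Finset.prod_ne_zero_iff.2 fun j hj =>
    mul_ne_zero (sub_ne_zero.2 (ht.ne (by simp)))
      (sub_ne_zero.2 (ht.ne (by simpa using Finset.ne_of_mem_erase hj)))
  let ε : Fin n → ℝ := fun i => if i ∈ u ∅ then θ i else -θ i
  have hε : ∀ i, ε i ≠ 0 := fun i => by by_cases hi : i ∈ u ∅ <;> simp [ε, hi, hθ]
  let η : Fin n → ℝ := fun d => ∏ j ∈ Finset.univ.erase d, pairSign t d (some (Sum.inl j))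
  have hη : ∀ d, η d ≠ 0 := fun d => Finset.prod_ne_zero_iff.2 fun j hj => by
    have := pairSign_vertexSelection_ne_zero ht (Finset.ne_of_mem_erase hj) ∅
    simpa [vertexSelection] using this
  -- The scaling of the complement makes the product in the P-condition equal to `-ε d ^ 2 * η d`
  -- times the product of pair signs at the vertex. Both points of each other pair lie on the same
  -- side of pair `d`, so the latter product has the sign of `η d` at every vertex.
  let s : Option (PGround n) → ℝ := fun e => e.elim 1 (Sum.elim ε fun i => -(ε i * η i))
  have hs : ∀ e, s e ≠ 0 := by
    rintro (_ | i | i)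
    · exact one_ne_zero
    · exact hε i
    · exact neg_ne_zero.2 (mul_ne_zero (hε i) (hη i))
  have hP : IsAlternatingConfiguration ((momentConfiguration n s t).submatrix id some) := by
    rw [isAlternatingConfiguration_moment_iff hs ht]
    intro v d
    have h1 : 0 < η d *
        ∏ j ∈ Finset.univ.erase d, pairSign t d (some (vertexSelection v j)) := by
      rw [← Finset.prod_mul_distrib]
      refine Finset.prod_pos fun j hj => ?_
      have hjd := Finset.ne_of_mem_erase hj
      have h2 := hR d j hjd.symm
      by_cases hadj : d ≠ j ∧ G.Adj d j
      · have h3 := h2.1 hadj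
        by_cases hv : j ∈ v
        · simpa [vertexSelection, hv] using mul_pos_of_neg_of_neg h3.1 h3.2
        · simpa [vertexSelection, hv] using mul_pos_of_neg_of_neg h3.1 h3.1
      · have h3 := h2.2 hadj
        by_cases hv : j ∈ v
        · simpa [vertexSelection, hv] using mul_pos h3.1 h3.2
        · simpa [vertexSelection, hv] using mul_pos h3.1 h3.1
    have h2 : 0 < ε d ^ 2 := by have := hε d; positivity
    have h3 := mul_pos h2 h1
    simp only [s, Option.elim, Sum.elim_inl, Sum.elim_inr]
    linarith
  let u' : Finset (Fin n) → Finset (Fin n) := fun v => Finset.univ.filter fun i =>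
    0 < bracket (momentConfiguration n s t) (Function.update (some ∘ vertexSelection v) i none) *
      bracket (momentConfiguration n s t) (some ∘ vertexSelection v)
  have hu' : ∀ v i, i ∈ u' v ↔
      0 < bracket (momentConfiguration n s t) (Function.update (some ∘ vertexSelection v) i none) *
        bracket (momentConfiguration n s t) (some ∘ vertexSelection v) := fun v i => by simp [u']
  have hsep : separationGraph t = G := by
    ext d i
    by_cases hdi : d = i
    · subst hdi
      simp [separationGraph, hl]
    · have h1 := hR d i hdi
      have h2 := hnone d
      simp only [separationGraph, hdi, false_or, mul_comm _ (pairSign t d none)]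
      rw [mul_neg_iff_of_pos_left h2]
      by_cases hadj : G.Adj d i
      · simp [hadj, (h1.1 ⟨hdi, hadj⟩).1]
      · simp [hadj, (h1.2 fun h => hadj h.2).1.le]
  have hinf := hP.hasInfluenceGraph hs ht hu'
  rw [hsep] at hinf
  have h0 : u ∅ = u' ∅ := by
    ext i
    obtain ⟨c, hc, h⟩ := exists_bracket_update_mul hs ht
      (some_comp_vertexSelection_injective (n := n) ∅) i
    have h1 := h none (some (Sum.inl i))
    have h2 : Function.update (some ∘ vertexSelection ∅) i (some (Sum.inl i)) =
        some ∘ vertexSelection ∅ := by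
      conv_rhs => rw [← Function.update_eq_self i (some ∘ vertexSelection ∅)]
      rfl
    rw [h2] at h1
    rw [hu', h1]
    have h3 : s none * s (some (Sum.inl i)) * ∏ j ∈ Finset.univ.erase i,
        ((t ((some ∘ vertexSelection ∅) j) - t none) *
          (t ((some ∘ vertexSelection ∅) j) - t (some (Sum.inl i)))) = ε i * θ i := by
      simp [s, θ, vertexSelection]
    rw [h3]
    have h4 := mul_self_pos.2 (hθ i)
    by_cases hi : i ∈ u ∅
    · simp only [hi, ε, if_true, true_iff]
      exact mul_pos hc h4
    · simp only [hi, ε, if_false, false_iff, not_lt]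
      have := mul_pos hc h4
      linarith
  have huu := hu.ext hinf h0
  exact ⟨s, t, hs, ht, hP, huu ▸ hu'⟩

theorem exists_isSimpleExtension {s t : Option (PGround n) → ℝ} (hs : ∀ e, s e ≠ 0)
    (ht : Function.Injective t)
    (hP : IsAlternatingConfiguration ((momentConfiguration n s t).submatrix id some)) :
    IsSimpleExtension (OrientedMatroid.ofMatrix (momentConfiguration n s t))
      (OrientedMatroid.ofMatrix (momentConfiguration n s t)).deletion := by
  have hV := isUniformConfiguration_moment (n := n) hs ht
  have hV' : IsUniformConfiguration ((momentConfiguration n s t).submatrix id some) :=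
    fun σ hσ => hV (some ∘ σ) ((Option.some_injective _).comp hσ)
  refine ⟨⟨?_, ?_⟩, rfl, exists_isAlternating (by simp; ring) hs ht⟩
  · rw [OrientedMatroid.deletion_ofMatrix]
    exact hV'.isPMatroid_iff.2 hP
  · rw [OrientedMatroid.deletion_ofMatrix]
    exact exists_isAlternating (by simp; ring) (fun e => hs (some e))
      (ht.comp (Option.some_injective _))

theorem IsForestOrder.permute {G : Digraph (Fin n)} {π : Equiv.Perm (Fin n)} :
    IsForestOrder (fun a b => a ≠ b ∧ (G.permute π).Adj a b) ↔
      IsForestOrder (fun a b => a ≠ b ∧ G.Adj a b) := by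
  have key : ∀ a b, (π a ≠ π b ∧ (G.permute π).Adj (π a) (π b)) ↔ a ≠ b ∧ G.Adj a b := by
    intro a b
    simp [Digraph.permute]
  constructor <;> rintro ⟨-, h2, h3⟩ <;> refine ⟨fun a h => h.1 rfl, ?_, ?_⟩
  · intro a b c hab hbc
    rw [← key] at *
    exact h2 _ _ _ hab hbc
  · intro a b c hac hbc hab
    rw [← key] at hac hbc
    simp only [← key]
    exact h3 _ _ _ hac hbc (π.injective.ne hab)
  · intro a b c
    obtain ⟨a, rfl⟩ := π.surjective a
    obtain ⟨b, rfl⟩ := π.surjective b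
    obtain ⟨c, rfl⟩ := π.surjective c
    simp only [key]
    exact h2 a b c
  · intro a b c hac hbc hab
    obtain ⟨a, rfl⟩ := π.surjective a
    obtain ⟨b, rfl⟩ := π.surjective b
    obtain ⟨c, rfl⟩ := π.surjective c
    rw [key] at hac hbc
    exact (h3 a b c hac hbc fun h => hab (congrArg π h)).imp (key _ _).2 (key _ _).2

/-- Converse of `IsRealizable.isForestOrder`: realizability depends on the influence graph alone,
which lets it pass along isomorphisms without transforming `M` and `q`. -/
theorem HasInfluenceGraph.isRealizable {u : Finset (Fin n) → Finset (Fin n)}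
    {G : Digraph (Fin n)} (hu : HasInfluenceGraph u G) (hl : ∀ d, G.Adj d d)
    (hG : IsForestOrder fun a b => a ≠ b ∧ G.Adj a b) : IsRealizable u := by
  obtain ⟨s, t, hs, ht, hP, h⟩ := hu.exists_configuration hl hG
  exact isRealizable_of_configuration (isUniformConfiguration_moment hs ht) hP h

end Main

theorem mainTheorem2 (n : ℕ) :
    {u : Finset (Fin n) → Finset (Fin n) |
        ∃ M Mhat, IsSimpleExtension Mhat M ∧ IsAssociatedOrientation Mhat u} =
      {u | IsMatousekTypeUSO u ∧ IsRealizable u} ∧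
    {u : Finset (Fin n) → Finset (Fin n) | IsMatousekTypeUSO u ∧ IsRealizable u} =
      {u | ∃ m, IsMatousekUSO m ∧ IsRealizable m ∧ OrientationIso m u} := by
  refine ⟨Set.ext fun u => ⟨?_, ?_⟩, Set.ext fun u => ⟨?_, ?_⟩⟩
  · rintro ⟨M, Mhat, hM, hu⟩
    exact hM.matousekType_and_realizable hu
  · rintro ⟨hu, hr⟩
    obtain ⟨G, hG, hinf⟩ := isMatousekTypeUSO_iff.1 hu
    obtain ⟨s, t, hs, ht, hP, h⟩ :=
      hinf.exists_configuration hG.1 (hr.isForestOrder hinf hG)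
    exact ⟨_, _, exists_isSimpleExtension hs ht hP,
      ((isUniformConfiguration_moment hs ht).isAssociatedOrientation_iff u).2 h⟩
  -- The graph of `u` is a permuted copy of that of `m`, so the forest property of the one gives
  -- realizability of the other.
  · rintro ⟨⟨hu, m, hm, hiso⟩, hr⟩
    obtain ⟨G, hG, hinf⟩ := hm.2.2
    obtain ⟨π, hπ⟩ := hiso.hasInfluenceGraph hinf
    exact ⟨m, hm, hinf.isRealizable hG.1
      (IsForestOrder.permute.1 (hr.isForestOrder hπ (hG.permute π))), hiso⟩
  · rintro ⟨m, hm, hr, hiso⟩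
    obtain ⟨G, hG, hinf⟩ := hm.2.2
    obtain ⟨π, hπ⟩ := hiso.hasInfluenceGraph hinf
    exact ⟨⟨hπ.isUSO (hG.permute π), m, hm, hiso⟩, hπ.isRealizable (hG.permute π).1
      (IsForestOrder.permute.2 (hr.isForestOrder hinf hG))⟩
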